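/- **Model.** For $w\ge 0$ the *unit-cost $w$-bit word RAM* has memory cells addressed by $w$-bit words and constantly many registers, each holding one $w$-bit word. Programs do not depend on $w$ and are built from the following instructions: loading a literal into a register; $+,-,\times,\div,\bmod$, bitwise and/or/xor and logical shifts on registers (unsigned, results modulo $2^w$); reading or writing the cell whose address is in a register; conditionals and while-loops on unsigned comparisons ($=$, $<$) of two registers. Every elementary instruction and every test costs one time step; the space is the number of memory cells of the machine, and any access outside these cells is forbidden. Symbols are arbitrary $w$-bit words. **Exact matching in $s$ streams.** A pattern $P$ of length $m\ge 1$ is given. First a *preprocessing* program, which is given only $P$ and $m$, is run (its space is bounded, its running time need only be finite). Then symbols arrive one at a time, each being appended to exactly one of $s$ initially empty streams, the order of arrivals being arbitrary and unbounded. After each arrival $(r,x)$ of a symbol $x$ in stream $r$, and before the next one, an *online* program has to report whether $P$ is a suffix of the current contents of stream $r$. **Theorem.** There are a constant $c$, a deterministic preprocessing program and a deterministic online program for the word RAM that solve exact matching in multiple streams in worst-case $O(1)$ time per arriving symbol and $O(m+s)$ words of space. More precisely, for every word size $w$ and every pattern $P$ of length $m\ge 1$ over the $w$-bit words with $cm\le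 2^w$, the preprocessing program halts, using no more than $cm$ memory cells (the *pattern space*); and for every $s\ge 0$ with $c(m+s)\le 2^w$ and every infinite sequence of arrivals in $s$ streams, the online program reports the correct answer after each arrival within at most $c$ steps, using at most $c(m+s)$ memory cells in total, of which the $cm$ cells of the pattern space are shared by all the streams and are only read, never written, in the online phase. -/

import Mathlib

/-! A deterministic unit-cost word RAM with structured programs, and the multiple-stream setting. -/

namespace WordRAM

/-- Machine words of `w` bits. Input symbols are words as well. -/
abbrev Word (w : ℕ) := BitVec w

/-- The state of the machine: registers and memory cells, each holding one word. Registers are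
named directly by the program (there is no indirect access to them), so a program uses only the
constantly many registers that occur in its text. -/
@[ext] structure State (w : ℕ) where
  reg : ℕ → Word w
  mem : ℕ → Word w

/-- Assign the word `v` to register `d`. -/
def State.setReg {w : ℕ} (σ : State w) (d : ℕ) (v : Word w) : State w :=
  { σ with reg := Function.update σ.reg d v }

/-- Write the word `v` to the memory cell with address `a`. -/
def State.setMem {w : ℕ} (σ : State w) (a : ℕ) (v : Word w) : State w :=
  { σ with mem := Function.update σ.mem a v }

/-- The binary word operations. -/
inductive Op where
  | add | sub | mul | div | mod | and | or | xor | shl | shr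

/-- Unsigned arithmetic modulo `2 ^ w`, bitwise operations and logical shifts. -/
def Op.eval {w : ℕ} : Op → Word w → Word w → Word w
  | .add, x, y => x + y
  | .sub, x, y => x - y
  | .mul, x, y => x * y
  | .div, x, y => x / y
  | .mod, x, y => x % y
  | .and, x, y => x &&& y
  | .or, x, y => x ||| y
  | .xor, x, y => x ^^^ y
  | .shl, x, y => x <<< y.toNat
  | .shr, x, y => x >>> y.toNat

/-- Comparisons of the contents of two registers. -/
inductive Test where
  | eq (a b : ℕ)
  | lt (a b : ℕ)

/-- The unsigned meaning of a comparison. -/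
def Test.Holds {w : ℕ} (σ : State w) : Test → Prop
  | .eq a b => σ.reg a = σ.reg b
  | .lt a b => (σ.reg a).toNat < (σ.reg b).toNat

/-- Programs of the RAM. All operands `d`, `a`, `b` are register names. They do not depend on the
word size. -/
inductive Cmd where
  /-- do nothing -/
  | skip
  /-- put the literal `n` (modulo `2 ^ w`) into register `d` -/
  | const (d n : ℕ)
  /-- apply `o` to the registers `a` and `b` and put the result into register `d` -/
  | op (o : Op) (d a b : ℕ)
  /-- read into register `d` the memory cell whose address is in register `a` -/
  | load (d a : ℕ)
  /-- write register `b` to the memory cell whose address is in register `a` -/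
  | store (a b : ℕ)
  /-- run `p`, then `q` -/
  | seq (p q : Cmd)
  /-- if `c` holds run `p`, else run `q` -/
  | ite (c : Test) (p q : Cmd)
  /-- while `c` holds run `p` -/
  | loop (c : Test) (p : Cmd)

/-- `Exec lo hi p σ t τ`: on a machine whose memory consists of the cells with addresses below
`hi`, those below `lo` being read-only, the program `p` started in `σ` halts in `τ` after exactly
`t` steps. Every elementary instruction and every evaluation of a test takes one step. An access
outside the memory, or a write to a read-only cell, blocks the machine: then there is no `τ`. -/
inductive Exec {w : ℕ} (lo hi : ℕ) : Cmd → State w → ℕ → State w → Prop where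
  | skip (σ : State w) : Exec lo hi .skip σ 1 σ
  | const (σ : State w) (d n : ℕ) :
      Exec lo hi (.const d n) σ 1 (σ.setReg d (BitVec.ofNat w n))
  | op (σ : State w) (o : Op) (d a b : ℕ) :
      Exec lo hi (.op o d a b) σ 1 (σ.setReg d (o.eval (σ.reg a) (σ.reg b)))
  | load (σ : State w) (d a : ℕ) (h : (σ.reg a).toNat < hi) :
      Exec lo hi (.load d a) σ 1 (σ.setReg d (σ.mem (σ.reg a).toNat))
  | store (σ : State w) (a b : ℕ) (hlo : lo ≤ (σ.reg a).toNat) (hhi : (σ.reg a).toNat < hi) :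
      Exec lo hi (.store a b) σ 1 (σ.setMem (σ.reg a).toNat (σ.reg b))
  | seq {p q : Cmd} {σ τ υ : State w} {t u : ℕ} (hp : Exec lo hi p σ t τ)
      (hq : Exec lo hi q τ u υ) : Exec lo hi (.seq p q) σ (t + u) υ
  | ite_true {c : Test} {p q : Cmd} {σ τ : State w} {t : ℕ} (hc : c.Holds σ)
      (hp : Exec lo hi p σ t τ) : Exec lo hi (.ite c p q) σ (1 + t) τ
  | ite_false {c : Test} {p q : Cmd} {σ τ : State w} {t : ℕ} (hc : ¬ c.Holds σ)
      (hq : Exec lo hi q σ t τ) : Exec lo hi (.ite c p q) σ (1 + t) τ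
  | loop_stop {c : Test} {p : Cmd} {σ : State w} (hc : ¬ c.Holds σ) :
      Exec lo hi (.loop c p) σ 1 σ
  | loop_step {c : Test} {p : Cmd} {σ τ υ : State w} {t u : ℕ} (hc : c.Holds σ)
      (hp : Exec lo hi p σ t τ) (hl : Exec lo hi (.loop c p) τ u υ) :
      Exec lo hi (.loop c p) σ (1 + t + u) υ

/-- The machine is deterministic: final state and running time are determined by the start. -/
theorem Exec.deterministic {w lo hi : ℕ} {p : Cmd} {σ τ : State w} {t : ℕ}
    (h : Exec lo hi p σ t τ) :
    ∀ {t' : ℕ} {τ' : State w}, Exec lo hi p σ t' τ' → t' = t ∧ τ' = τ := by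
  induction h with
  | skip | const | op | load | store => intro _ _ h'; cases h'; exact ⟨rfl, rfl⟩
  | seq _ _ ih₁ ih₂ =>
    intro _ _ h'
    cases h' with
    | seq h₁ h₂ =>
      obtain ⟨rfl, rfl⟩ := ih₁ h₁
      obtain ⟨rfl, rfl⟩ := ih₂ h₂
      exact ⟨rfl, rfl⟩
  | ite_true hc _ ih =>
    intro _ _ h'
    cases h' with
    | ite_true _ h₁ => obtain ⟨rfl, rfl⟩ := ih h₁; exact ⟨rfl, rfl⟩
    | ite_false hn _ => exact absurd hc hn
  | ite_false hc _ ih =>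
    intro _ _ h'
    cases h' with
    | ite_true hn _ => exact absurd hn hc
    | ite_false _ h₁ => obtain ⟨rfl, rfl⟩ := ih h₁; exact ⟨rfl, rfl⟩
  | loop_stop hc =>
    intro _ _ h'
    cases h' with
    | loop_stop _ => exact ⟨rfl, rfl⟩
    | loop_step hn _ _ => exact absurd hn hc
  | loop_step hc _ _ ih₁ ih₂ =>
    intro _ _ h'
    cases h' with
    | loop_stop hn => exact absurd hc hn
    | loop_step _ h₁ h₂ =>
      obtain ⟨rfl, rfl⟩ := ih₁ h₁
      obtain ⟨rfl, rfl⟩ := ih₂ h₂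
      exact ⟨rfl, rfl⟩

/-- The start of the preprocessing phase: the pattern is in the cells `0, …, m - 1`, its length
`m` is in register `0`, and everything else is zero. -/
def initState {w : ℕ} (P : List (Word w)) : State w where
  reg := fun i => if i = 0 then BitVec.ofNat w P.length else 0
  mem := fun a => P.getD a 0

/-- An arrival `(r, x)` is presented to the online phase by putting the index `r` of the stream
into register `0` and the symbol `x` into register `1`; nothing else changes. -/
def State.arrive {w s : ℕ} (σ : State w) (e : Fin s × Word w) : State w :=
  (σ.setReg 0 (BitVec.ofNat w (e.1 : ℕ))).setReg 1 e.2

/-- The contents of stream `r` after the first `n` arrivals `A 0, …, A (n - 1)`, in order. -/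
def streamText {w s : ℕ} (A : ℕ → Fin s × Word w) (n : ℕ) (r : Fin s) : List (Word w) :=
  (((List.range n).map A).filter (fun e => e.1 = r)).map Prod.snd

/-- The online phase: starting from `σ₀`, the program `step` is run once for each arrival, on the
state left by the previous run. Each run takes at most `T` steps, on a memory of `hi` cells of
which the first `lo` are read-only, and leaves in register `0` the answer for the stream that was
just updated: `1` if the pattern now ends at its last symbol, and `0` otherwise. -/
def MatchesOnline {w s : ℕ} (lo hi T : ℕ) (step : Cmd) (P : List (Word w)) (σ₀ : State w)
    (A : ℕ → Fin s × Word w) : Prop :=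
  ∃ σ : ℕ → State w, σ 0 = σ₀ ∧ ∀ n : ℕ,
    (∃ t ≤ T, Exec lo hi step ((σ n).arrive (A n)) t (σ (n + 1))) ∧
    (σ (n + 1)).reg 0 = if P <:+ streamText A (n + 1) (A n).1 then 1 else 0

end WordRAM

/-!
The matching automaton of the pattern `P` has the states `0, …, m`; after a text `t` it is in the
state `matchLen P t`, the length of the longest prefix of `P` that is a suffix of `t`. One word
per stream stores the state of that stream, so it is enough to look up one transition of the
automaton in constant time in a read-only structure of `O(m)` words that does not depend on the
text.

A transition from state `j` to a nonzero state `k + 1` on the letter `x` belongs to the longest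
border `k` of the prefix of length `j`, this prefix itself included, that is followed by `x` in
`P`. The letters on which state `j` has such a transition, `b j` in number, are kept in a separate
table of `O((b j) ^ 2)` cells, addressed by a multiply-shift hash function `x ↦ a * x / D` without
collisions on these letters (`exists_injOn_hash`). An entry is `k + 1`, and comparing `P[k]` with
the letter read tells whether the entry applies.

These quadratic tables have linear total size because `∑ j, (b j) ^ 2 = O(m)`
(`sum_sq_card_rowLetters_le`). If `a < b` are borders of the same prefix that are followed by
different letters, then no prefix longer than `b` has a period `d ≤ a` (`IsBorder.lt_period`).
Hence the borders of one prefix that are the longest ones for their letters grow exponentially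
with their rank, and so does the smallest period of such a border. If a state has a border of rank
`n + 3`, take the occurrence of the border of rank `n + 2` that ends at this state. For different
states these occurrences start at different places, and the distances of these places are at least
`(3 / 2) ^ n`, as they are periods of a border of rank `n + 2` (`pow_le_sub_starts`). So at most
`2 * m / (3 / 2) ^ n` states have more than `n + 3` transitions.

The preprocessing has no time limit. It finds the borders by definition and tries, for each state,
all hash functions in the order of increasing table size; the existence of a good one bounds both
the duration of the search and the space (`searchHash_spec`). Its correctness is proved with the
usual rules for total correctness (`Reach`). The online program contains no loop, so that its
length bounds its running time (`Exec.le_steps`).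
-/

namespace WordRAM

/-! ### Borders of prefixes and the letters that follow them -/

/-- The prefix of length `k` of the infinite word `f 0, f 1, …` is a border of its prefix of length
`j`. The trivial border `k = j` is allowed. -/
def IsBorder {α : Type*} (f : ℕ → α) (k j : ℕ) : Prop :=
  k ≤ j ∧ ∀ i < k, f i = f (j - k + i)

instance {α : Type*} [DecidableEq α] (f : ℕ → α) (k j : ℕ) : Decidable (IsBorder f k j) :=
  inferInstanceAs (Decidable (_ ∧ _))

section Borders

variable {α : Type*} {f : ℕ → α}

theorem IsBorder.refl (f : ℕ → α) (j : ℕ) : IsBorder f j j :=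
  ⟨le_rfl, fun i _ => by simp⟩

theorem IsBorder.of_le {a b j : ℕ} (ha : IsBorder f a j) (hb : IsBorder f b j) (hab : a ≤ b) :
    IsBorder f a b := by
  refine ⟨hab, fun i hi => ?_⟩
  have hbj := hb.1
  rw [ha.2 i hi, hb.2 (b - a + i) (by omega)]
  congr 1
  omega

/-- If `a` is a border of `b` and different letters follow them, then every prefix longer than `b`
has all its periods larger than `a`. A period `d ≤ a` would transport both letters back by `d`, into
the range where the border makes them equal. -/
theorem IsBorder.lt_period {a b c d : ℕ} (h : IsBorder f a b) (hne : f a ≠ f b) (hbc : b < c)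
    (hd0 : 0 < d) (hd : ∀ i, i + d < c → f i = f (i + d)) : a < d := by
  by_contra! hda
  have hab := h.1
  apply hne
  have h1 := hd (b - d) (by omega)
  have h2 := hd (a - d) (by omega)
  rw [Nat.sub_add_cancel (by omega)] at h1 h2
  rw [← h1, ← h2, h.2 (a - d) (by omega)]
  congr 1
  omega

variable [DecidableEq α]

/-- The borders of the prefix of length `j` that are proper prefixes of a pattern of length `m`. -/
def borders (f : ℕ → α) (m j : ℕ) : Finset ℕ := (Finset.range m).filter (IsBorder f · j)

/-- The letters by which the borders of the prefix of length `j` can be extended inside the pattern: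
the letters on which the matching automaton does not go from state `j` back to state `0`. -/
def rowLetters (f : ℕ → α) (m j : ℕ) : Finset α := (borders f m j).image f

/-- The borders that are the longest ones extended by their letter. They correspond to the
transitions out of state `j` that do not go to state `0`. -/
def maxBorders (f : ℕ → α) (m j : ℕ) : Finset ℕ :=
  (borders f m j).filter fun k => ∀ k' ∈ borders f m j, f k' = f k → k' ≤ k

theorem mem_borders {m j k : ℕ} : k ∈ borders f m j ↔ k < m ∧ IsBorder f k j := by
  simp [borders]

theorem mem_maxBorders {m j k : ℕ} : k ∈ maxBorders f m j ↔
    (k < m ∧ IsBorder f k j) ∧ ∀ k' < m, IsBorder f k' j → f k' = f k → k' ≤ k := by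
  simp [maxBorders, mem_borders]

theorem card_rowLetters_le (m j : ℕ) : (rowLetters f m j).card ≤ (maxBorders f m j).card := by
  refine (Finset.card_le_card fun x hx => ?_).trans (Finset.card_image_le (f := f))
  obtain ⟨k, hk, rfl⟩ := Finset.mem_image.1 hx
  obtain ⟨q, hq, hmax⟩ := ((borders f m j).filter (f · = f k)).exists_max_image id
    ⟨k, by simp [hk]⟩
  rw [Finset.mem_filter] at hq
  refine Finset.mem_image.2 ⟨q, ?_, hq.2⟩
  refine Finset.mem_filter.2 ⟨hq.1, fun k' hk' h => ?_⟩
  exact hmax k' (by simp [hk', h, hq.2])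

theorem letter_ne_of_mem_maxBorders {m j a b : ℕ} (ha : a ∈ maxBorders f m j)
    (hb : b ∈ maxBorders f m j) (hab : a < b) : f a ≠ f b := by
  rw [mem_maxBorders] at ha hb
  intro h
  have := ha.2 b hb.1.1 hb.1.2 h.symm
  omega

/-- Three maximal borders of the same prefix satisfy a Fibonacci-type inequality. -/
theorem add_lt_of_mem_maxBorders {m j a b c : ℕ} (ha : a ∈ maxBorders f m j)
    (hb : b ∈ maxBorders f m j) (hc : c ∈ maxBorders f m j) (hab : a < b) (hbc : b < c) :
    a + b < c := by
  have hne := letter_ne_of_mem_maxBorders ha hb hab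
  rw [mem_maxBorders] at ha hb hc
  have hbc' := hb.1.2.of_le hc.1.2 hbc.le
  have := (ha.1.2.of_le hb.1.2 hab.le).lt_period hne hbc (d := c - b) (by omega) (by
    intro i hi
    rw [hbc'.2 i (by omega), add_comm])
  omega

/-- The maximal borders in increasing order. -/
def nthBorder (f : ℕ → α) (m j : ℕ) : Fin (maxBorders f m j).card ↪o ℕ :=
  (maxBorders f m j).orderEmbOfFin rfl

theorem nthBorder_mem (m j : ℕ) (i : Fin (maxBorders f m j).card) :
    nthBorder f m j i ∈ maxBorders f m j :=
  Finset.orderEmbOfFin_mem _ _ _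

theorem nthBorder_lt {m j i i' : ℕ} (h : i < i') (h' : i' < (maxBorders f m j).card) :
    nthBorder f m j ⟨i, h.trans h'⟩ < nthBorder f m j ⟨i', h'⟩ :=
  (nthBorder f m j).strictMono h

/-- The maximal borders of a prefix grow exponentially. -/
theorem pow_le_nthBorder (m j : ℕ) : ∀ i (h : i < (maxBorders f m j).card),
    (3 / 2 : ℚ) ^ i ≤ (nthBorder f m j ⟨i, h⟩ : ℚ) + 1
  | 0, h => by simp
  | 1, h => by
    have h1 := nthBorder_lt (f := f) zero_lt_one h
    have : (1 : ℚ) ≤ nthBorder f m j ⟨1, h⟩ := by exact_mod_cast (by omega)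
    norm_num
    linarith
  | i + 2, h => by
    have h1 := pow_le_nthBorder m j i (by omega)
    have h2 := pow_le_nthBorder m j (i + 1) (by omega)
    have h3 := add_lt_of_mem_maxBorders (nthBorder_mem m j ⟨i, by omega⟩)
      (nthBorder_mem m j ⟨i + 1, by omega⟩) (nthBorder_mem m j ⟨i + 2, h⟩)
      (nthBorder_lt (by omega) _) (nthBorder_lt (by omega) _)
    have h4 : (nthBorder f m j ⟨i, by omega⟩ : ℚ) + nthBorder f m j ⟨i + 1, by omega⟩ + 1 ≤
      nthBorder f m j ⟨i + 2, h⟩ := by exact_mod_cast h3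
    have h5 : (0 : ℚ) < (3 / 2) ^ i := by positivity
    rw [pow_succ] at h2 ⊢
    rw [pow_succ]
    linarith

/-- Two prefixes with more than `n + 3` maximal borders: the occurrences of their maximal borders of
rank `n + 2` that end these prefixes start far apart. Indeed the distance of the starts is a period
of the shorter one of these borders. -/
theorem pow_le_sub_starts {m n j j' : ℕ} (hj : j ≤ m) (hj' : j' ≤ m) (hjj : j ≠ j')
    (h : n + 3 < (maxBorders f m j).card) (h' : n + 3 < (maxBorders f m j').card)
    (hp : j - nthBorder f m j ⟨n + 2, by omega⟩ ≤ j' - nthBorder f m j' ⟨n + 2, by omega⟩) :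
    (3 / 2 : ℚ) ^ n ≤ ((j' - nthBorder f m j' ⟨n + 2, by omega⟩ -
      (j - nthBorder f m j ⟨n + 2, by omega⟩) : ℕ) : ℚ) := by
  set c := nthBorder f m j ⟨n + 2, by omega⟩ with hc
  set c' := nthBorder f m j' ⟨n + 2, by omega⟩ with hc'
  have hcm := mem_maxBorders.1 (nthBorder_mem (f := f) m j ⟨n + 2, by omega⟩)
  have hcm' := mem_maxBorders.1 (nthBorder_mem (f := f) m j' ⟨n + 2, by omega⟩)
  rw [← hc] at hcm
  rw [← hc'] at hcm'
  have hcj := hcm.1.2.1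
  have hcj' := hcm'.1.2.1
  -- The border of rank `n + 2` is not the longest one, hence is proper.
  have proper : ∀ i, ∀ h : n + 3 < (maxBorders f m i).card,
      nthBorder f m i ⟨n + 2, by omega⟩ < i := fun i h =>
    (nthBorder_lt (by omega) h).trans_le (mem_maxBorders.1 (nthBorder_mem m i _)).1.2.1
  -- An equal start would allow the longer occurrence to extend the shorter one.
  have distinct : ∀ i i' (h : n + 3 < (maxBorders f m i).card)
      (h' : n + 3 < (maxBorders f m i').card), i < i' → i' ≤ m →
      i - nthBorder f m i ⟨n + 2, by omega⟩ ≠ i' - nthBorder f m i' ⟨n + 2, by omega⟩ := by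
    intro i i' h h' hii hi' heq
    have h1 := mem_maxBorders.1 (nthBorder_mem (f := f) m i ⟨n + 2, by omega⟩)
    have h2 := mem_maxBorders.1 (nthBorder_mem (f := f) m i' ⟨n + 2, by omega⟩)
    have h3 := h1.1.2.1
    have h4 := h2.1.2.1
    have h5 := h2.1.2.2 (nthBorder f m i ⟨n + 2, by omega⟩) (by omega)
    rw [← heq, Nat.sub_add_cancel h3] at h5
    have := h1.2 i (by omega) (IsBorder.refl f i) h5.symm
    have := proper i h
    omega
  have hlt : j - c < j' - c' := by
    refine lt_of_le_of_ne hp ?_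
    rcases lt_or_gt_of_ne hjj with hl | hl
    · exact distinct j j' h h' hl hj'
    · exact (distinct j' j h' h hl hj).symm
  set d := j' - c' - (j - c) with hd
  have period : ∀ i, i + d < min c c' → f i = f (i + d) := by
    intro i hi
    rw [hcm'.1.2.2 i (by omega), hcm.1.2.2 (i + d) (by omega)]
    congr 1
    omega
  have key : ∀ i (h : n + 3 < (maxBorders f m i).card),
      nthBorder f m i ⟨n + 2, by omega⟩ = min c c' → (3 / 2 : ℚ) ^ n ≤ d := by
    intro i h hi
    have ha := nthBorder_mem (f := f) m i ⟨n, by omega⟩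
    have hb := nthBorder_mem (f := f) m i ⟨n + 1, by omega⟩
    have hab := nthBorder_lt (f := f) (m := m) (j := i) (show n < n + 1 by omega) (by omega)
    have hbc := nthBorder_lt (f := f) (m := m) (j := i) (show n + 1 < n + 2 by omega) (by omega)
    have h1 := ((mem_maxBorders.1 ha).1.2.of_le (mem_maxBorders.1 hb).1.2 hab.le).lt_period
      (letter_ne_of_mem_maxBorders ha hb hab) (c := min c c') (hbc.trans_eq hi)
      (d := d) (by omega) period
    refine (pow_le_nthBorder (f := f) m i n (by omega)).trans ?_
    exact_mod_cast h1
  rcases le_total c c' with hl | hl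
  · exact key j h (by rw [min_eq_left hl])
  · exact key j' h' (by rw [min_eq_right hl])

/-- The number of states with many transitions decreases exponentially with the number of
transitions. -/
theorem card_filter_maxBorders_le (m n : ℕ) :
    (((Finset.range (m + 1)).filter fun j => n + 3 < (maxBorders f m j).card).card : ℚ) *
      (3 / 2) ^ n ≤ 2 * m := by
  set S := (Finset.range (m + 1)).filter fun j => n + 3 < (maxBorders f m j).card with hS
  have hmem : ∀ j, j ∈ S ↔ j ≤ m ∧ n + 3 < (maxBorders f m j).card := by
    intro j
    rw [hS, Finset.mem_filter, Finset.mem_range, Nat.lt_succ_iff]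
  rcases S.eq_empty_or_nonempty with h0 | ⟨j₀, hj₀⟩
  · rw [h0]
    simp
  set G := ⌈(3 / 2 : ℚ) ^ n⌉₊ with hG
  have hG0 : 0 < G := Nat.ceil_pos.2 (by positivity)
  have hGm : G ≤ m := by
    have h1 := ((hmem _).1 hj₀).2
    have h2 := pow_le_nthBorder (f := f) m j₀ n (by omega)
    have h3 := (mem_maxBorders.1 (nthBorder_mem (f := f) m j₀ ⟨n, by omega⟩)).1.1
    refine Nat.ceil_le.2 (h2.trans ?_)
    exact_mod_cast h3
  -- Dividing the starts by `G` sends the states injectively to `0, …, m / G`.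
  have hcard : S.card ≤ m / G + 1 := by
    rw [← Finset.card_range (m / G + 1)]
    let start : ℕ → ℕ := fun j =>
      if h : n + 3 < (maxBorders f m j).card then j - nthBorder f m j ⟨n + 2, by omega⟩ else 0
    refine Finset.card_le_card_of_injOn (fun j => start j / G) ?_ ?_
    · intro j hj
      have hj := (hmem j).1 hj
      simp only [start, hj.2, dif_pos, Finset.coe_range, Set.mem_Iio, Nat.lt_succ_iff]
      exact Nat.div_le_div_right (by omega)
    · have aux : ∀ j ∈ S, ∀ j' ∈ S, j ≠ j' → start j ≤ start j' → start j / G ≠ start j' / G := by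
        intro j hj j' hj' hne hle heq
        have hj := (hmem j).1 hj
        have hj' := (hmem j').1 hj'
        simp only [start, hj.2, hj'.2, dif_pos] at hle heq
        have h1 := Nat.ceil_le.2 (pow_le_sub_starts hj.1 hj'.1 hne hj.2 hj'.2 hle)
        rw [← hG] at h1
        have h2 : (j - nthBorder f m j ⟨n + 2, by omega⟩ + G) / G ≤
          (j' - nthBorder f m j' ⟨n + 2, by omega⟩) / G := Nat.div_le_div_right (by omega)
        rw [Nat.add_div_right _ hG0] at h2
        omega
      intro j hj j' hj' heq
      by_contra hne
      rcases le_total (start j) (start j') with hl | hl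
      · exact aux j hj j' hj' hne hl heq
      · exact aux j' hj' j hj (Ne.symm hne) hl heq.symm
  have h1 : S.card * G ≤ 2 * m := by
    calc S.card * G ≤ (m / G + 1) * G := Nat.mul_le_mul_right _ hcard
      _ = m / G * G + G := by ring
      _ ≤ m + m := add_le_add (Nat.div_mul_le_self _ _) hGm
      _ = 2 * m := by ring
  calc (S.card : ℚ) * (3 / 2) ^ n ≤ S.card * G := by
        gcongr
        exact Nat.le_ceil _
    _ ≤ 2 * m := by exact_mod_cast h1

/-- The numbers of letters on which the states of the matching automaton can move to a nonzero state
have a linear sum of squares. -/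
theorem sum_sq_card_rowLetters_le (m : ℕ) :
    ∑ j ∈ Finset.range (m + 1), (rowLetters f m j).card ^ 2 ≤ 105 * (m + 1) := by
  set b : ℕ → ℕ := fun j => (rowLetters f m j).card with hb
  -- The number of states with more than `n` transitions.
  set N : ℕ → ℕ := fun n => ((Finset.range (m + 1)).filter fun j => n < b j).card with hN
  have hNle : ∀ n, (N n : ℚ) ≤ 7 * (m + 1) * (2 / 3) ^ n := by
    intro n
    have hpow : (3 / 2 : ℚ) ^ n * (2 / 3) ^ n = 1 := by rw [← mul_pow]; norm_num
    have hpos : (0 : ℚ) < (2 / 3) ^ n := by positivity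
    suffices h : (N n : ℚ) * (3 / 2) ^ n ≤ 7 * (m + 1) by
      calc (N n : ℚ) = N n * (3 / 2) ^ n * (2 / 3) ^ n := by rw [mul_assoc, hpow, mul_one]
        _ ≤ _ := by gcongr
    rcases Nat.lt_or_ge n 4 with hn | hn
    · have h1 : (N n : ℚ) ≤ m + 1 := by
        have : N n ≤ m + 1 := (Finset.card_filter_le _ _).trans (by simp)
        exact_mod_cast this
      have h2 : (3 / 2 : ℚ) ^ n ≤ 7 := by
        interval_cases n <;> norm_num
      rw [mul_comm (7 : ℚ)]
      gcongr
    · obtain ⟨k, rfl⟩ := Nat.exists_eq_add_of_le' (show 3 ≤ n by omega)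
      have h1 := card_filter_maxBorders_le (f := f) m k
      have h2 : N (k + 3) ≤ ((Finset.range (m + 1)).filter
          fun j => k + 3 < (maxBorders f m j).card).card := by
        refine Finset.card_le_card fun j hj => ?_
        rw [Finset.mem_filter] at hj ⊢
        exact ⟨hj.1, hj.2.trans_le (card_rowLetters_le m j)⟩
      have h3 : (N (k + 3) : ℚ) * (3 / 2) ^ k ≤ 2 * m := by
        refine le_trans ?_ h1
        gcongr
      have h4 : (0 : ℚ) ≤ m := by positivity
      rw [pow_add, ← mul_assoc]
      norm_num
      linarith
  have hbm : ∀ j, b j ≤ m := fun j =>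
    (Finset.card_image_le.trans (Finset.card_filter_le _ _)).trans (by simp)
  have hsum : ∑ j ∈ Finset.range (m + 1), b j ^ 2 = ∑ n ∈ Finset.range m, (2 * n + 1) * N n := by
    have hsq : ∀ j, b j ^ 2 = ∑ n ∈ Finset.range m, if n < b j then 2 * n + 1 else 0 := by
      intro j
      rw [← Finset.sum_filter]
      have : (Finset.range m).filter (· < b j) = Finset.range (b j) := by
        ext n
        have := hbm j
        simp only [Finset.mem_filter, Finset.mem_range]
        omega
      rw [this]
      induction b j with
      | zero => simp
      | succ n ih => rw [Finset.sum_range_succ, ← ih]; ring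
    simp_rw [hsq]
    rw [Finset.sum_comm]
    refine Finset.sum_congr rfl fun n _ => ?_
    rw [← Finset.sum_filter, Finset.sum_const, smul_eq_mul, mul_comm]
  have hgeom : ∀ M : ℕ, ∑ n ∈ Finset.range M, (2 * n + 1 : ℚ) * (2 / 3) ^ n =
      15 - (6 * M + 15) * (2 / 3) ^ M := by
    intro M
    induction M with
    | zero => simp
    | succ M ih =>
      rw [Finset.sum_range_succ, ih, pow_succ]
      push_cast
      ring
  have hfin : ((∑ j ∈ Finset.range (m + 1), b j ^ 2 : ℕ) : ℚ) ≤ (105 * (m + 1) : ℕ) := by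
    rw [hsum]
    push_cast
    calc ∑ n ∈ Finset.range m, (2 * n + 1 : ℚ) * N n
        ≤ ∑ n ∈ Finset.range m, (2 * n + 1 : ℚ) * (7 * (m + 1) * (2 / 3) ^ n) := by
          gcongr with n
          exact hNle n
      _ = 7 * (m + 1) * ∑ n ∈ Finset.range m, (2 * n + 1 : ℚ) * (2 / 3) ^ n := by
          rw [Finset.mul_sum]
          refine Finset.sum_congr rfl fun n _ => ?_
          ring
      _ ≤ 7 * (m + 1) * 15 := by
          rw [hgeom]
          gcongr
          have : (0 : ℚ) ≤ (6 * m + 15) * (2 / 3) ^ m := by positivity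
          linarith
      _ = 105 * (m + 1) := by ring
  exact_mod_cast hfin

end Borders

/-! ### Multiply-shift hashing -/

/-- The multiply-shift hash function with multiplier `a`. The shift is expressed by the division by
`D`, which is used with powers of two. -/
def hash {w : ℕ} (a D x : Word w) : Word w := a * x / D

theorem card_filter_mod_two_pow_le (w n B : ℕ) (h : n ≤ w) (p : ℕ → Prop) [DecidablePred p]
    (hcard : ((Finset.range (2 ^ n)).filter p).card ≤ B) :
    ((Finset.range (2 ^ w)).filter fun c => p (c % 2 ^ n)).card ≤ 2 ^ (w - n) * B := by
  calc _ ≤ (Finset.range (2 ^ (w - n)) ×ˢ (Finset.range (2 ^ n)).filter p).card := by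
        refine Finset.card_le_card_of_injOn (fun c => (c / 2 ^ n, c % 2 ^ n)) ?_ ?_
        · intro c hc
          simp only [Finset.coe_filter, Finset.mem_range, Set.mem_ofPred_eq] at hc
          simp only [Finset.coe_product, Set.mem_prod, Finset.coe_range, Set.mem_Iio,
            Finset.coe_filter, Finset.mem_range, Set.mem_ofPred_eq]
          refine ⟨?_, Nat.mod_lt _ (by positivity), hc.2⟩
          rw [Nat.div_lt_iff_lt_mul (by positivity), ← pow_add, Nat.sub_add_cancel h]
          exact hc.1
        · intro c _ c' _ heq
          simp only [Prod.mk.injEq] at heq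
          rw [← Nat.div_add_mod c (2 ^ n), ← Nat.div_add_mod c' (2 ^ n), heq.1, heq.2]
    _ ≤ _ := by
        rw [Finset.card_product, Finset.card_range]
        gcongr

/-- The multiplier `a` brings the distance `d` within `2 ^ (w - l)` of `0` modulo `2 ^ w`, so that
two keys at distance `d` may collide in a table of `2 ^ l` cells. -/
def Near (w l d a : ℕ) : Prop :=
  a * d % 2 ^ w < 2 ^ (w - l) ∨ 2 ^ w < a * d % 2 ^ w + 2 ^ (w - l)

instance (w l d a : ℕ) : Decidable (Near w l d a) := inferInstanceAs (Decidable (_ ∨ _))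

/-- The odd numbers below `2 ^ w`, which serve as multipliers. -/
def odds (w : ℕ) : Finset ℕ := (Finset.range (2 ^ w)).filter Odd

theorem card_odds {w : ℕ} (hw : 0 < w) : (odds w).card = 2 ^ (w - 1) := by
  obtain ⟨n, rfl⟩ := Nat.exists_eq_succ_of_ne_zero hw.ne'
  have : odds (n + 1) = (Finset.range (2 ^ n)).image fun i => 2 * i + 1 := by
    ext a
    simp only [odds, Finset.mem_filter, Finset.mem_range, Finset.mem_image]
    constructor
    · rintro ⟨h, k, rfl⟩
      exact ⟨k, by rw [pow_succ] at h; omega, rfl⟩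
    · rintro ⟨k, hk, rfl⟩
      exact ⟨by rw [pow_succ]; omega, k, rfl⟩
  rw [this, Finset.card_image_of_injective _ (fun a b h => by simpa using h), Finset.card_range]
  simp

theorem card_near_two_pow {w l i : ℕ} (hi : i < w) :
    ((odds w).filter (Near w l (2 ^ i))).card ≤ 2 * 2 ^ (w - l) := by
  -- The residue of `a * 2 ^ i` is determined by the low `w - i` bits of `a`.
  have hmod : ∀ a, a * 2 ^ i % 2 ^ w = a % 2 ^ (w - i) * 2 ^ i := by
    intro a
    rw [← Nat.mul_mod_mul_right, ← pow_add, Nat.sub_add_cancel hi.le]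
  have hwi : 2 ^ w = 2 ^ (w - i) * 2 ^ i := by rw [← pow_add, Nat.sub_add_cancel hi.le]
  have hi0 : 0 < 2 ^ i := by positivity
  rcases Nat.lt_or_ge i (w - l) with h | h
  · have hwl : 2 ^ (w - l) = 2 ^ (w - l - i) * 2 ^ i := by
      rw [← pow_add, Nat.sub_add_cancel h.le]
    have hle : 2 ^ (w - l - i) ≤ 2 ^ (w - i) := Nat.pow_le_pow_right (by norm_num) (by omega)
    have hB : ((Finset.range (2 ^ (w - i))).filter fun c =>
        c < 2 ^ (w - l - i) ∨ 2 ^ (w - i) < c + 2 ^ (w - l - i)).card ≤ 2 * 2 ^ (w - l - i) := by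
      calc _ ≤ (Finset.range (2 ^ (w - l - i)) ∪
            Finset.Ico (2 ^ (w - i) - 2 ^ (w - l - i)) (2 ^ (w - i))).card := by
            refine Finset.card_le_card fun c hc => ?_
            simp only [Finset.mem_filter, Finset.mem_range, Finset.mem_union,
              Finset.mem_Ico] at hc ⊢
            omega
        _ ≤ _ := by
            refine (Finset.card_union_le _ _).trans ?_
            rw [Finset.card_range, Nat.card_Ico]
            omega
    calc _ ≤ ((Finset.range (2 ^ w)).filter fun a => a % 2 ^ (w - i) < 2 ^ (w - l - i) ∨
          2 ^ (w - i) < a % 2 ^ (w - i) + 2 ^ (w - l - i)).card := by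
          refine Finset.card_le_card fun a ha => ?_
          simp only [odds, Finset.mem_filter, Near, hmod] at ha ⊢
          rw [hwi, hwl, ← add_mul, Nat.mul_lt_mul_right hi0, Nat.mul_lt_mul_right hi0] at ha
          exact ⟨by rw [hwi]; exact ha.1.1, ha.2⟩
      _ ≤ 2 ^ (w - (w - i)) * (2 * 2 ^ (w - l - i)) :=
          card_filter_mod_two_pow_le w (w - i) _ (by omega) _ hB
      _ = 2 * 2 ^ (w - l) := by
          rw [hwl, show w - (w - i) = i by omega]
          ring
  · -- A nonzero multiple of `2 ^ i` is never near.
    rw [Finset.filter_false_of_mem]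
    · simp
    · intro a ha
      simp only [odds, Finset.mem_filter] at ha
      have hodd : a % 2 ^ (w - i) % 2 = 1 := by
        rw [Nat.mod_mod_of_dvd _ (dvd_pow_self 2 (by omega))]
        exact Nat.odd_iff.1 ha.2
      have hlt : a % 2 ^ (w - i) < 2 ^ (w - i) := Nat.mod_lt _ (by positivity)
      have hle : 2 ^ (w - l) ≤ 2 ^ i := Nat.pow_le_pow_right (by norm_num) h
      unfold Near
      rw [hmod, not_or, not_lt, not_lt]
      constructor
      · calc 2 ^ (w - l) ≤ 1 * 2 ^ i := by omega
          _ ≤ _ := Nat.mul_le_mul_right _ (by omega)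
      · calc a % 2 ^ (w - i) * 2 ^ i + 2 ^ (w - l) ≤ (a % 2 ^ (w - i) + 1) * 2 ^ i := by
              rw [add_mul]; omega
          _ ≤ 2 ^ (w - i) * 2 ^ i := Nat.mul_le_mul_right _ (by omega)
          _ = 2 ^ w := hwi.symm

/-- For a fixed nonzero distance, few odd multipliers are bad: multiplication with the odd part of
the distance permutes the odd multipliers and reduces the claim to a power of two. -/
theorem card_near_le {w l d : ℕ} (hd0 : 0 < d) (hd : d < 2 ^ w) :
    ((odds w).filter (Near w l d)).card ≤ 2 * 2 ^ (w - l) := by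
  obtain ⟨i, u, hu, rfl⟩ := Nat.exists_eq_two_pow_mul_odd hd0.ne'
  have hi : i < w := by
    by_contra! h
    have h1 : 2 ^ w ≤ 2 ^ i := Nat.pow_le_pow_right (by norm_num) h
    have h2 : 1 ≤ u := hu.pos
    nlinarith
  refine le_trans ?_ (card_near_two_pow hi)
  refine Finset.card_le_card_of_injOn (fun a => a * u % 2 ^ w) ?_ ?_
  · intro a ha
    simp only [odds, Finset.coe_filter, Finset.mem_filter, Finset.mem_range, Set.mem_ofPred_eq]
      at ha ⊢
    refine ⟨⟨Nat.mod_lt _ (by positivity), ?_⟩, ?_⟩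
    · rw [Nat.odd_iff, Nat.mod_mod_of_dvd _ (dvd_pow_self 2 (by omega)), ← Nat.odd_iff]
      exact ha.1.2.mul hu
    · have : a * u % 2 ^ w * 2 ^ i % 2 ^ w = a * (2 ^ i * u) % 2 ^ w := by
        rw [Nat.mod_mul_mod]
        congr 1
        ring
      unfold Near
      rw [this]
      exact ha.2
  · intro a ha b hb h
    simp only [odds, Finset.coe_filter, Finset.mem_filter, Finset.mem_range, Set.mem_ofPred_eq]
      at ha hb
    have hcop : Nat.gcd (2 ^ w) u = 1 := (Nat.coprime_two_left.2 hu).pow_left w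
    have h1 : a ≡ b [MOD 2 ^ w] := Nat.ModEq.cancel_right_of_coprime hcop h
    rwa [Nat.ModEq, Nat.mod_eq_of_lt ha.1.1, Nat.mod_eq_of_lt hb.1.1] at h1

theorem near_of_div_eq {w l x y a : ℕ} (hxy : y < x)
    (h : a * x % 2 ^ w / 2 ^ (w - l) = a * y % 2 ^ w / 2 ^ (w - l)) : Near w l (x - y) a := by
  set X := a * x % 2 ^ w
  set Y := a * y % 2 ^ w
  have hX : X < 2 ^ w := Nat.mod_lt _ (by positivity)
  have hY : Y < 2 ^ w := Nat.mod_lt _ (by positivity)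
  have hD : 0 < 2 ^ (w - l) := by positivity
  have h1 := Nat.div_add_mod X (2 ^ (w - l))
  have h2 := Nat.div_add_mod Y (2 ^ (w - l))
  have h3 := Nat.mod_lt X hD
  have h4 := Nat.mod_lt Y hD
  rw [h] at h1
  have hsum : (a * (x - y) % 2 ^ w + Y) % 2 ^ w = X := by
    rw [← Nat.add_mod, ← mul_add, Nat.sub_add_cancel hxy.le]
  have hZ : a * (x - y) % 2 ^ w < 2 ^ w := Nat.mod_lt _ (by positivity)
  unfold Near
  set Z := a * (x - y) % 2 ^ w
  rcases Nat.lt_or_ge (Z + Y) (2 ^ w) with hlt | hge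
  · rw [Nat.mod_eq_of_lt hlt] at hsum
    left
    omega
  · rw [Nat.mod_eq_sub_mod hge, Nat.mod_eq_of_lt (by omega)] at hsum
    right
    omega

theorem toNat_hash {w l : ℕ} (hl0 : 0 < l) (hl : l ≤ w) (a x : Word w) :
    (hash a (BitVec.ofNat w (2 ^ (w - l))) x).toNat =
      a.toNat * x.toNat % 2 ^ w / 2 ^ (w - l) := by
  rw [hash, BitVec.toNat_udiv, BitVec.toNat_mul, BitVec.toNat_ofNat,
    Nat.mod_eq_of_lt (Nat.pow_lt_pow_right (by norm_num) (by omega) : 2 ^ (w - l) < 2 ^ w)]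

theorem toNat_hash_lt {w l : ℕ} (hl0 : 0 < l) (hl : l ≤ w) (a x : Word w) :
    (hash a (BitVec.ofNat w (2 ^ (w - l))) x).toNat < 2 ^ l := by
  rw [toNat_hash hl0 hl, Nat.div_lt_iff_lt_mul (by positivity), ← pow_add, Nat.add_sub_cancel' hl]
  exact Nat.mod_lt _ (by positivity)

/-- A set of `b` words has a perfect multiply-shift hash function into a table of `2 ^ l > 4 b ^ 2`
cells: each of the fewer than `b ^ 2` pairs excludes at most a fraction `4 / 2 ^ l` of the odd
multipliers. -/
theorem exists_injOn_hash {w l : ℕ} (S : Finset (Word w)) (hl0 : 0 < l) (hl : l ≤ w)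
    (hS : 4 * S.card ^ 2 < 2 ^ l) :
    ∃ a : Word w, Set.InjOn (hash a (BitVec.ofNat w (2 ^ (w - l)))) S := by
  have hcard : ((S ×ˢ S).biUnion fun z => (odds w).filter fun a =>
      z.2.toNat < z.1.toNat ∧ Near w l (z.1.toNat - z.2.toNat) a).card < (odds w).card := by
    calc _ ≤ (S ×ˢ S).card * (2 * 2 ^ (w - l)) := by
          refine Finset.card_biUnion_le_card_mul _ _ _ fun z _ => ?_
          by_cases h : z.2.toNat < z.1.toNat
          · simp only [h, true_and]
            exact card_near_le (by omega) (by have := z.1.isLt; omega)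
          · simp [h]
      _ = S.card ^ 2 * 2 * 2 ^ (w - l) := by rw [Finset.card_product]; ring
      _ < 2 ^ (l - 1) * 2 ^ (w - l) := by
          have : 2 ^ l = 2 * 2 ^ (l - 1) := by rw [← pow_succ', Nat.sub_add_cancel hl0]
          gcongr
          omega
      _ = (odds w).card := by
          rw [card_odds (by omega), ← pow_add]
          congr 1
          omega
  obtain ⟨a, ha, hbad⟩ := Finset.exists_mem_notMem_of_card_lt_card hcard
  have haw : a < 2 ^ w := Finset.mem_range.1 (Finset.mem_filter.1 ha).1
  have aux : ∀ x ∈ S, ∀ y ∈ S, y.toNat < x.toNat →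
      hash (BitVec.ofNat w a) (BitVec.ofNat w (2 ^ (w - l))) x ≠
        hash (BitVec.ofNat w a) (BitVec.ofNat w (2 ^ (w - l))) y := by
    intro x hx y hy hlt heq
    have h := congrArg BitVec.toNat heq
    rw [toNat_hash hl0 hl, toNat_hash hl0 hl, BitVec.toNat_ofNat, Nat.mod_eq_of_lt haw] at h
    refine hbad (Finset.mem_biUnion.2 ⟨(x, y), Finset.mem_product.2 ⟨hx, hy⟩, ?_⟩)
    exact Finset.mem_filter.2 ⟨ha, hlt, near_of_div_eq hlt h⟩
  refine ⟨BitVec.ofNat w a, fun x hx y hy heq => ?_⟩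
  rcases lt_trichotomy x.toNat y.toNat with h | h | h
  · exact absurd heq.symm (aux y hy x hx h)
  · exact BitVec.eq_of_toNat_eq h
  · exact absurd heq (aux x hx y hy h)

/-! ### The matching automaton -/

section Automaton

variable {α : Type*}

/-- The length `k + 1` is reached by a letter if and only if the length `k` was possible before it
and the letter is the next one of the pattern. -/
theorem take_succ_suffix_append_iff (P t : List α) (x d : α) {k : ℕ} (hk : k < P.length) :
    P.take (k + 1) <:+ t ++ [x] ↔ P.take k <:+ t ∧ P.getD k d = x := by
  rw [List.take_succ_eq_append_getElem hk, List.getD_eq_getElem _ _ hk]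
  constructor
  · rintro ⟨s, hs⟩
    rw [← List.append_assoc] at hs
    have := List.append_inj' hs rfl
    exact ⟨⟨s, this.1⟩, by simpa using this.2⟩
  · rintro ⟨⟨s, hs⟩, rfl⟩
    exact ⟨s, by rw [← List.append_assoc, hs]⟩

theorem take_suffix_take_iff (P : List α) (d : α) {k j : ℕ} (hkj : k ≤ j) (hj : j ≤ P.length) :
    P.take k <:+ P.take j ↔ IsBorder (fun i => P.getD i d) k j := by
  have hlen : (P.take j).length - (P.take k).length = j - k := by simp [hj, hkj.trans hj]
  rw [List.suffix_iff_eq_drop, hlen]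
  constructor
  · intro h
    refine ⟨hkj, fun i hi => ?_⟩
    have := congrArg (fun l => l.getD i d) h
    simpa [List.getD_eq_getElem?_getD, List.getElem?_take, hi, List.getElem?_drop,
      show j - k + i < j by omega] using this
  · intro h
    refine List.ext_getElem ?_ fun i h1 h2 => ?_
    · simp; omega
    · have hi : i < k := by simp at h1; omega
      have := h.2 i hi
      simp only at this
      rw [List.getD_eq_getElem _ _ (by omega), List.getD_eq_getElem _ _ (by omega)] at this
      simpa using this

variable [DecidableEq α]

/-- The state of the matching automaton of `P` after the text `t`: the length of the longest prefix
of `P` that is a suffix of `t`. -/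
def matchLen (P t : List α) : ℕ := Nat.findGreatest (fun k => P.take k <:+ t) P.length

theorem matchLen_le (P t : List α) : matchLen P t ≤ P.length := Nat.findGreatest_le _

theorem take_matchLen_suffix (P t : List α) : P.take (matchLen P t) <:+ t :=
  Nat.findGreatest_spec (P := fun k => P.take k <:+ t) (Nat.zero_le _) (by simp)

theorem le_matchLen {P t : List α} {k : ℕ} (hk : k ≤ P.length) (h : P.take k <:+ t) :
    k ≤ matchLen P t := Nat.le_findGreatest hk h

theorem suffix_iff_matchLen_eq (P t : List α) : P <:+ t ↔ matchLen P t = P.length := by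
  constructor
  · intro h
    exact le_antisymm (matchLen_le P t) (le_matchLen le_rfl (by simpa using h))
  · intro h
    have := take_matchLen_suffix P t
    rwa [h, List.take_length] at this

theorem matchLen_nil (P : List α) : matchLen P [] = 0 := by
  have h := (take_matchLen_suffix P []).length_le
  rw [List.length_take, min_eq_left (matchLen_le P [])] at h
  simpa using h

/-- The transition function of the automaton on states `j`: the recursion that avoids the text. -/
theorem matchLen_append (P t : List α) (x : α) :
    matchLen P (t ++ [x]) = matchLen P (P.take (matchLen P t) ++ [x]) := by
  apply le_antisymm
  · refine le_matchLen (matchLen_le _ _) ?_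
    have h := take_matchLen_suffix P (t ++ [x])
    have hle := matchLen_le P (t ++ [x])
    cases hk : matchLen P (t ++ [x]) with
    | zero => simp
    | succ k =>
      rw [hk] at h hle
      rw [take_succ_suffix_append_iff P _ x x (by omega)] at h ⊢
      refine ⟨?_, h.2⟩
      refine List.suffix_of_suffix_length_le h.1 (take_matchLen_suffix P t) ?_
      have := le_matchLen (by omega) h.1
      simp only [List.length_take]
      omega
  · refine le_matchLen (matchLen_le _ _) ((take_matchLen_suffix P _).trans ?_)
    obtain ⟨s, hs⟩ := take_matchLen_suffix P t
    exact ⟨s, by rw [← List.append_assoc, hs]⟩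

/-- A transition to a nonzero state extends the longest border that is followed by the letter
read. -/
theorem matchLen_take_append_eq_succ (P : List α) (d x : α) {j k : ℕ} (hj : j ≤ P.length)
    (hk : k < P.length) (hb : IsBorder (fun i => P.getD i d) k j) (hx : P.getD k d = x)
    (hmax : ∀ k' < P.length, IsBorder (fun i => P.getD i d) k' j → P.getD k' d = x → k' ≤ k) :
    matchLen P (P.take j ++ [x]) = k + 1 := by
  apply le_antisymm
  · have h := take_matchLen_suffix P (P.take j ++ [x])
    have hle := matchLen_le P (P.take j ++ [x])
    cases hk' : matchLen P (P.take j ++ [x]) with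
    | zero => simp
    | succ k' =>
      rw [hk'] at h hle
      rw [take_succ_suffix_append_iff P _ x d (by omega)] at h
      have hk'j : k' ≤ j := by
        have := h.1.length_le
        simp only [List.length_take] at this
        omega
      have := hmax k' (by omega) ((take_suffix_take_iff P d hk'j hj).1 h.1) h.2
      omega
  · refine le_matchLen hk ?_
    rw [take_succ_suffix_append_iff P _ x d hk]
    exact ⟨(take_suffix_take_iff P d hb.1 hj).2 hb, hx⟩

theorem matchLen_take_append_eq_zero (P : List α) (d x : α) {j : ℕ} (hj : j ≤ P.length)
    (hx : ∀ k < P.length, IsBorder (fun i => P.getD i d) k j → P.getD k d ≠ x) :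
    matchLen P (P.take j ++ [x]) = 0 := by
  have h := take_matchLen_suffix P (P.take j ++ [x])
  have hle := matchLen_le P (P.take j ++ [x])
  cases hk' : matchLen P (P.take j ++ [x]) with
  | zero => rfl
  | succ k' =>
    rw [hk'] at h hle
    rw [take_succ_suffix_append_iff P _ x d (by omega)] at h
    have hk'j : k' ≤ j := by
      have := h.1.length_le
      simp only [List.length_take] at this
      omega
    exact absurd h.2 (hx k' (by omega) ((take_suffix_take_iff P d hk'j hj).1 h.1))

end Automaton

/-! ### Total correctness of programs -/

infixr:60 " ;; " => Cmd.seq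

variable {w : ℕ}

@[simp] theorem State.reg_setReg (σ : State w) (d e : ℕ) (v : Word w) :
    (σ.setReg d v).reg e = if e = d then v else σ.reg e := by
  simp [State.setReg, Function.update_apply]

@[simp] theorem State.mem_setReg (σ : State w) (d : ℕ) (v : Word w) :
    (σ.setReg d v).mem = σ.mem := rfl

@[simp] theorem State.reg_setMem (σ : State w) (a : ℕ) (v : Word w) :
    (σ.setMem a v).reg = σ.reg := rfl

@[simp] theorem State.mem_setMem (σ : State w) (a p : ℕ) (v : Word w) :
    (σ.setMem a v).mem p = if p = a then v else σ.mem p := by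
  simp [State.setMem, Function.update_apply]

/-- The program `p` started in `σ`, on `hi` memory cells of which the first `lo` are read-only,
halts in a state that satisfies `Q`. -/
def Reach (lo hi : ℕ) (p : Cmd) (σ : State w) (Q : State w → Prop) : Prop :=
  ∃ t τ, Exec lo hi p σ t τ ∧ Q τ

namespace Reach

variable {lo hi : ℕ} {σ : State w} {Q R : State w → Prop}

theorem mono {p : Cmd} (h : Reach lo hi p σ R) (hR : ∀ τ, R τ → Q τ) : Reach lo hi p σ Q := by
  obtain ⟨t, τ, h, hτ⟩ := h
  exact ⟨t, τ, h, hR τ hτ⟩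

theorem skip (h : Q σ) : Reach lo hi .skip σ Q := ⟨_, _, .skip σ, h⟩

theorem const {d n : ℕ} (h : Q (σ.setReg d (BitVec.ofNat w n))) : Reach lo hi (.const d n) σ Q :=
  ⟨_, _, .const σ d n, h⟩

theorem op {o : Op} {d a b : ℕ} (h : Q (σ.setReg d (o.eval (σ.reg a) (σ.reg b)))) :
    Reach lo hi (.op o d a b) σ Q :=
  ⟨_, _, .op σ o d a b, h⟩

theorem load {d a : ℕ} (ha : (σ.reg a).toNat < hi)
    (h : Q (σ.setReg d (σ.mem (σ.reg a).toNat))) : Reach lo hi (.load d a) σ Q :=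
  ⟨_, _, .load σ d a ha, h⟩

theorem store {a b : ℕ} (ha : (σ.reg a).toNat < hi)
    (h : Q (σ.setMem (σ.reg a).toNat (σ.reg b)))
    (hlo : lo ≤ (σ.reg a).toNat := by exact Nat.zero_le _) : Reach lo hi (.store a b) σ Q :=
  ⟨_, _, .store σ a b hlo ha, h⟩

theorem seq {p q : Cmd} (h : Reach lo hi p σ fun τ => Reach lo hi q τ Q) :
    Reach lo hi (p ;; q) σ Q := by
  obtain ⟨t, τ, hp, u, υ, hq, hQ⟩ := h
  exact ⟨_, _, .seq hp hq, hQ⟩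

theorem ite {c : Test} {p q : Cmd} (hp : c.Holds σ → Reach lo hi p σ Q)
    (hq : ¬ c.Holds σ → Reach lo hi q σ Q) : Reach lo hi (.ite c p q) σ Q := by
  by_cases hc : c.Holds σ
  · obtain ⟨t, τ, h, hQ⟩ := hp hc
    exact ⟨_, _, .ite_true hc h, hQ⟩
  · obtain ⟨t, τ, h, hQ⟩ := hq hc
    exact ⟨_, _, .ite_false hc h, hQ⟩

/-- The rule for loops with an invariant `I` and a variant `μ`. -/
theorem loop {c : Test} {p : Cmd} (I : State w → Prop) (μ : State w → ℕ)
    (hstep : ∀ τ, I τ → c.Holds τ → Reach lo hi p τ fun υ => I υ ∧ μ υ < μ τ)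
    (hexit : ∀ τ, I τ → ¬ c.Holds τ → Q τ) (hσ : I σ) : Reach lo hi (.loop c p) σ Q := by
  induction hn : μ σ using Nat.strong_induction_on generalizing σ with
  | _ n ih =>
    by_cases hc : c.Holds σ
    · obtain ⟨t, τ, h, hI, hlt⟩ := hstep σ hσ hc
      obtain ⟨u, υ, h', hQ⟩ := ih (μ τ) (hn ▸ hlt) hI rfl
      exact ⟨_, _, .loop_step hc h h', hQ⟩
    · exact ⟨_, _, Exec.loop_stop hc, hexit σ hσ hc⟩

end Reach

/-- A machine does not change anything outside its memory. -/
theorem Exec.mem_of_le {lo hi : ℕ} {p : Cmd} {σ τ : State w} {t : ℕ} (h : Exec lo hi p σ t τ)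
    {a : ℕ} (ha : hi ≤ a) : τ.mem a = σ.mem a := by
  induction h with
  | skip | const | op | load | loop_stop => rfl
  | store σ b _ _ hhi => simp [show a ≠ (σ.reg b).toNat by omega]
  | seq _ _ ih₁ ih₂ => rw [ih₂, ih₁]
  | ite_true _ _ ih => exact ih
  | ite_false _ _ ih => exact ih
  | loop_step _ _ _ ih₁ ih₂ => rw [ih₂, ih₁]

theorem toNat_add_of_lt {x y : Word w} (h : x.toNat + y.toNat < 2 ^ w) :
    (x + y).toNat = x.toNat + y.toNat := by
  rw [BitVec.toNat_add, Nat.mod_eq_of_lt h]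

theorem toNat_one (h : 1 < 2 ^ w) : (1 : Word w).toNat = 1 := by
  simpa using Nat.mod_eq_of_lt h

theorem toNat_ofNat_of_lt {n : ℕ} (h : n < 2 ^ w) : (BitVec.ofNat w n).toNat = n := by
  rw [BitVec.toNat_ofNat, Nat.mod_eq_of_lt h]

/-- The states agree on the registers below `n`. -/
def Agree (n : ℕ) (σ τ : State w) : Prop := ∀ d < n, τ.reg d = σ.reg d

theorem Agree.trans {n n' : ℕ} {σ τ υ : State w} (h : Agree n σ τ) (h' : Agree n' τ υ)
    (hn : n ≤ n') : Agree n σ υ := fun d hd => (h' d (hd.trans_le hn)).trans (h d hd)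

/-! ### The preprocessing program

The registers are numbered such that each part of the program changes only registers above a
certain number: the constants `rLen` to `rHalf` survive the construction of the tables, the
position `rState`, `rBase` in this construction survives the search for a hash function, the hash
function `rMul`, `rDiv`, `rSize` survives the attempt to fill a table with it, and the remaining
registers are working registers. `rStreams` is the address of the cells of the streams, `rHalf`
contains `2 ^ (w - 1)`, and `rCount` is the successor of the border `rBord`. Registers `0` and `1`
receive the input. -/

notation "rLen" => 2
notation "rRows" => 3
notation "rStreams" => 4
notation "rOne" => 5
notation "rZero" => 6
notation "rHalf" => 7
notation "rState" => 8
notation "rBase" => 9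
notation "rMul" => 10
notation "rDiv" => 11
notation "rSize" => 12
notation "rFail" => 13
notation "rCount" => 14
notation "rBord" => 15
notation "rEntry" => 16
notation "rOk" => 17
notation "rX" => 18
notation "rIdx" => 19
notation "rPos" => 20
notation "rY" => 21

/-- Clear the table. -/
def clearTable : Cmd :=
  .const rIdx 0 ;;
  .loop (.lt rIdx rSize) (
    .op .add rPos rBase rIdx ;;
    .store rPos rZero ;;
    .op .add rIdx rIdx rOne)

/-- Test whether the prefix of the length given in `rBord` is a border of the one given in `rState`,
and put the answer into `rOk`. -/
def testBorder : Cmd :=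
  .const rOk 1 ;;
  .const rIdx 0 ;;
  .op .sub rPos rState rBord ;;
  .loop (.lt rIdx rBord) (
    .load rX rIdx ;;
    .load rY rPos ;;
    .ite (.eq rX rY) .skip (.const rOk 0) ;;
    .op .add rIdx rIdx rOne ;;
    .op .add rPos rPos rOne)

theorem clearTable_spec {hi : ℕ} {σ : State w} (hhi : hi ≤ 2 ^ w) (hw : 0 < w)
    (hone : σ.reg rOne = 1) (hzero : σ.reg rZero = 0)
    (hfit : (σ.reg rBase).toNat + (σ.reg rSize).toNat ≤ hi) :
    Reach 0 hi clearTable σ fun τ => Agree 19 σ τ ∧ ∀ p, τ.mem p =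
      if (σ.reg rBase).toNat ≤ p ∧ p < (σ.reg rBase).toNat + (σ.reg rSize).toNat then 0
      else σ.mem p := by
  have h1 : (1 : Word w).toNat = 1 := toNat_one (Nat.one_lt_two_pow hw.ne')
  refine .seq (.const (.loop (fun τ => Agree 19 σ τ ∧ (τ.reg rIdx).toNat ≤ (σ.reg rSize).toNat ∧
    ∀ p, τ.mem p = if (σ.reg rBase).toNat ≤ p ∧ p < (σ.reg rBase).toNat + (τ.reg rIdx).toNat
      then 0 else σ.mem p) (fun τ => (σ.reg rSize).toNat - (τ.reg rIdx).toNat) ?_ ?_ ?_))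
  · rintro τ ⟨hag, hle, hmem⟩ hc
    have hb := hag rBase (by decide)
    have hs := hag rSize (by decide)
    have hz := hag rZero (by decide)
    have ho := hag rOne (by decide)
    have hlt : (τ.reg rIdx).toNat < (σ.reg rSize).toNat := by rw [← hs]; exact hc
    have hpos : (τ.reg rBase + τ.reg rIdx).toNat = (σ.reg rBase).toNat + (τ.reg rIdx).toNat := by
      rw [toNat_add_of_lt, hb]
      rw [hb]; omega
    have hidx : (τ.reg rIdx + τ.reg rOne).toNat = (τ.reg rIdx).toNat + 1 := by
      rw [toNat_add_of_lt, ho, hone, h1]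
      rw [ho, hone, h1]
      have := (σ.reg rSize).isLt
      omega
    refine .seq (.op (.seq (.store ?_ (.op ⟨⟨?_, ?_, ?_⟩, ?_⟩))))
    · simp [Op.eval, hpos]
      omega
    · intro d hd
      simp [show d ≠ rIdx by omega, show d ≠ rPos by omega, hag d hd]
    · simp [Op.eval, hidx]
      omega
    · intro p
      simp [Op.eval, hidx, hpos, hmem, hz, hzero]
      split_ifs <;> first | rfl | omega
    · simp [Op.eval, hidx]
      omega
  · rintro τ ⟨hag, hle, hmem⟩ hc
    refine ⟨hag, ?_⟩
    have : (τ.reg rIdx).toNat = (σ.reg rSize).toNat := by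
      have hs := hag rSize (by decide)
      refine le_antisymm hle ?_
      rw [← hs]
      exact not_lt.1 hc
    rwa [this] at hmem
  · refine ⟨fun d hd => by simp [show d ≠ rIdx by omega], by simp, fun p => by simp⟩

theorem testBorder_spec {hi m : ℕ} {σ : State w} {f : ℕ → Word w} (hm : m ≤ hi) (hw : 0 < w)
    (hone : σ.reg rOne = 1) (hf : ∀ i < m, σ.mem i = f i) (hj : (σ.reg rState).toNat ≤ m)
    (hk : (σ.reg rBord).toNat ≤ (σ.reg rState).toNat) :
    Reach 0 hi testBorder σ fun τ => Agree 17 σ τ ∧ τ.mem = σ.mem ∧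
      τ.reg rOk = if IsBorder f (σ.reg rBord).toNat (σ.reg rState).toNat then 1 else 0 := by
  have h1 : (1 : Word w).toNat = 1 := toNat_one (Nat.one_lt_two_pow hw.ne')
  set k := (σ.reg rBord).toNat with hkdef
  set j := (σ.reg rState).toNat with hjdef
  refine .seq (.const (.seq (.const (.seq (.op (.loop (fun τ => Agree 17 σ τ ∧ τ.mem = σ.mem ∧
    (τ.reg rIdx).toNat ≤ k ∧ (τ.reg rPos).toNat = j - k + (τ.reg rIdx).toNat ∧
    τ.reg rOk = if ∀ i < (τ.reg rIdx).toNat, f i = f (j - k + i) then 1 else 0)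
      (fun τ => k - (τ.reg rIdx).toNat) ?_ ?_ ?_))))))
  · rintro τ ⟨hag, hmem, hle, hpos, hok⟩ hc
    have hb := hag rBord (by decide)
    have ho := hag rOne (by decide)
    have hlt : (τ.reg rIdx).toNat < k := by rw [hkdef, ← hb]; exact hc
    have hk2 : k < 2 ^ w := (σ.reg rBord).isLt
    have hj2 : j < 2 ^ w := (σ.reg rState).isLt
    have hidx : (τ.reg rIdx + τ.reg rOne).toNat = (τ.reg rIdx).toNat + 1 := by
      rw [toNat_add_of_lt] <;> rw [ho, hone, h1]
      omega
    have hpos' : (τ.reg rPos + τ.reg rOne).toNat = j - k + ((τ.reg rIdx).toNat + 1) := by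
      rw [toNat_add_of_lt] <;> rw [ho, hone, h1, hpos]
      · omega
      · omega
    have hx : τ.mem (τ.reg rIdx).toNat = f (τ.reg rIdx).toNat := by
      rw [hmem, hf _ (by omega)]
    have hy : τ.mem (τ.reg rPos).toNat = f (j - k + (τ.reg rIdx).toNat) := by
      rw [hmem, hpos, hf _ (by omega)]
    have hsplit : (∀ i ≤ (τ.reg rIdx).toNat, f i = f (j - k + i)) ↔
        (∀ i < (τ.reg rIdx).toNat, f i = f (j - k + i)) ∧
          f (τ.reg rIdx).toNat = f (j - k + (τ.reg rIdx).toNat) := by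
      constructor
      · exact fun h => ⟨fun i hi => h i hi.le, h _ le_rfl⟩
      · rintro ⟨h, h'⟩ i hi
        rcases hi.lt_or_eq with hi | rfl
        · exact h i hi
        · exact h'
    refine .seq (.load (by omega) (.seq (.load (by simp; omega) (.seq (.ite ?_ ?_)))))
    · intro hc'
      have hc' : f (τ.reg rIdx).toNat = f (j - k + (τ.reg rIdx).toNat) := by
        simpa [Test.Holds, hx, hy] using hc'
      refine .skip (.seq (.op (.op ⟨⟨?_, ?_, ?_, ?_, ?_⟩, ?_⟩)))
      · intro d hd
        simp [show d ≠ rIdx by omega, show d ≠ rPos by omega, show d ≠ rX by omega,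
          show d ≠ rY by omega, hag d hd]
      · simpa using hmem
      · simp [Op.eval, hidx]
        omega
      · simp [Op.eval, hidx, hpos']
      · simp [Op.eval, hidx, hsplit, hc', hok]
      · simp [Op.eval, hidx]
        omega
    · intro hc'
      have hc' : ¬ f (τ.reg rIdx).toNat = f (j - k + (τ.reg rIdx).toNat) := by
        simpa [Test.Holds, hx, hy] using hc'
      refine .const (.seq (.op (.op ⟨⟨?_, ?_, ?_, ?_, ?_⟩, ?_⟩)))
      · intro d hd
        simp [show d ≠ rIdx by omega, show d ≠ rPos by omega, show d ≠ rX by omega,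
          show d ≠ rY by omega, show d ≠ rOk by omega, hag d hd]
      · simpa using hmem
      · simp [Op.eval, hidx]
        omega
      · simp [Op.eval, hidx, hpos']
      · simp [Op.eval, hidx, hsplit, hc']
      · simp [Op.eval, hidx]
        omega
  · rintro τ ⟨hag, hmem, hle, hpos, hok⟩ hc
    have : (τ.reg rIdx).toNat = k := by
      have hb := hag rBord (by decide)
      refine le_antisymm hle ?_
      rw [hkdef, ← hb]
      exact not_lt.1 hc
    rw [this] at hok
    exact ⟨hag, hmem, by rw [hok]; simp [IsBorder, hk]⟩
  · refine ⟨?_, rfl, by simp, ?_, by simp⟩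
    · intro d hd
      simp [show d ≠ rIdx by omega, show d ≠ rPos by omega, show d ≠ rOk by omega]
    · have := BitVec.toNat_sub_of_le (show σ.reg rBord ≤ σ.reg rState by rwa [BitVec.le_def])
      simpa [Op.eval, -BitVec.toNat_sub] using this

/-- The prefix of length `k` is a border of the prefix of length `j` and can be extended inside a
pattern of length `m`. -/
def Extends (f : ℕ → Word w) (m j k : ℕ) : Prop := k < m ∧ IsBorder f k j

/-- The table at address `base` after the insertion of all extensible borders of length at least
`n`, in decreasing order of length. A border `k` is stored as the number `k + 1`, and empty cells
contain `0`. As long as the word `fail` is not `1`, all borders with the same hash value are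
followed by the same letter, and the longest one is stored; otherwise the hash function is not
perfect. -/
structure Filled (f : ℕ → Word w) (m j n base : ℕ) (a D fail : Word w) (mem : ℕ → Word w) :
    Prop where
  entry : ∀ x : Word w, mem (base + (hash a D x).toNat) = 0 ∨ ∃ k, n ≤ k ∧ Extends f m j k ∧
    (mem (base + (hash a D x).toNat)).toNat = k + 1 ∧ hash a D (f k) = hash a D x
  ne_zero : ∀ k, n ≤ k → Extends f m j k → mem (base + (hash a D (f k)).toNat) ≠ 0
  longest : fail ≠ 1 → ∀ k, n ≤ k → Extends f m j k →
    f ((mem (base + (hash a D (f k)).toNat)).toNat - 1) = f k ∧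
      k + 1 ≤ (mem (base + (hash a D (f k)).toNat)).toNat
  collision : fail = 1 → ¬ Set.InjOn (hash a D) (rowLetters f m j)

theorem Extends.mem_rowLetters {f : ℕ → Word w} {m j k : ℕ} (h : Extends f m j k) :
    f k ∈ rowLetters f m j :=
  Finset.mem_image_of_mem f (mem_borders.2 h)

theorem Filled.skip {f : ℕ → Word w} {m j n base : ℕ} {a D fail : Word w} {mem : ℕ → Word w}
    (h : Filled f m j (n + 1) base a D fail mem) (hn : ¬ Extends f m j n) :
    Filled f m j n base a D fail mem where
  entry x := (h.entry x).imp id fun ⟨k, hk, hk'⟩ => ⟨k, by omega, hk'⟩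
  ne_zero k hk hk' := h.ne_zero k (by
    rcases hk.lt_or_eq with h | rfl
    · exact h
    · exact absurd hk' hn) hk'
  longest hf k hk hk' := h.longest hf k (by
    rcases hk.lt_or_eq with h | rfl
    · exact h
    · exact absurd hk' hn) hk'
  collision := h.collision

theorem Filled.insert_empty {f : ℕ → Word w} {m j k base : ℕ} {a D fail v : Word w}
    {mem : ℕ → Word w} (h : Filled f m j (k + 1) base a D fail mem) (hk : Extends f m j k)
    (hmem : mem (base + (hash a D (f k)).toNat) = 0) (hv : v.toNat = k + 1) :
    Filled f m j k base a D fail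
      fun p => if p = base + (hash a D (f k)).toNat then v else mem p := by
  have hne : ∀ x, base + (hash a D x).toNat = base + (hash a D (f k)).toNat ↔
      hash a D x = hash a D (f k) := fun x => by
    rw [add_right_inj, BitVec.toNat_inj]
  -- No border inserted before has the same hash value.
  have hold : ∀ k', k ≤ k' → Extends f m j k' →
      k' = k ∨ k + 1 ≤ k' ∧ hash a D (f k') ≠ hash a D (f k) := fun k' hle hk' => by
    rcases hle.eq_or_lt with rfl | hlt
    · exact .inl rfl
    · refine .inr ⟨hlt, fun heq => ?_⟩
      have := h.ne_zero k' hlt hk'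
      rw [heq] at this
      exact this hmem
  refine ⟨fun x => ?_, fun k' hle hk' => ?_, fun hf k' hle hk' => ?_, h.collision⟩
  · by_cases hx : hash a D x = hash a D (f k)
    · exact .inr ⟨k, le_rfl, hk, by simp [hx, hv], hx.symm⟩
    · simp only [hne, hx, if_false]
      exact (h.entry x).imp id fun ⟨k', hk', h'⟩ => ⟨k', by omega, h'⟩
  · rcases hold k' hle hk' with rfl | ⟨hlt, hx⟩
    · simp only [if_true]
      intro h0
      rw [h0] at hv
      simp at hv
    · simp only [hne, hx, if_false]
      exact h.ne_zero k' hlt hk'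
  · rcases hold k' hle hk' with rfl | ⟨hlt, hx⟩
    · simp [hv]
    · simp only [hne, hx, if_false]
      exact h.longest hf k' hlt hk'

theorem Filled.insert_same {f : ℕ → Word w} {m j k base : ℕ} {a D fail : Word w}
    {mem : ℕ → Word w} (h : Filled f m j (k + 1) base a D fail mem)
    (hmem : mem (base + (hash a D (f k)).toNat) ≠ 0)
    (hf : f ((mem (base + (hash a D (f k)).toNat)).toNat - 1) = f k) :
    Filled f m j k base a D fail mem := by
  refine ⟨fun x => (h.entry x).imp id fun ⟨k', hk', h'⟩ => ⟨k', by omega, h'⟩,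
    fun k' hle hk' => ?_, fun hfail k' hle hk' => ?_, h.collision⟩
  · rcases hle.eq_or_lt with rfl | hlt
    · exact hmem
    · exact h.ne_zero k' hlt hk'
  · rcases hle.eq_or_lt with rfl | hlt
    · refine ⟨hf, ?_⟩
      obtain h0 | ⟨k', hle', -, hv, -⟩ := h.entry (f k)
      · exact absurd h0 hmem
      · omega
    · exact h.longest hfail k' hlt hk'

theorem Filled.insert_collision {f : ℕ → Word w} {m j k base : ℕ} {a D fail : Word w}
    {mem : ℕ → Word w} (h : Filled f m j (k + 1) base a D fail mem) (hk : Extends f m j k)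
    (hmem : mem (base + (hash a D (f k)).toNat) ≠ 0)
    (hf : f ((mem (base + (hash a D (f k)).toNat)).toNat - 1) ≠ f k) :
    Filled f m j k base a D 1 mem := by
  refine ⟨fun x => (h.entry x).imp id fun ⟨k', hk', h'⟩ => ⟨k', by omega, h'⟩,
    fun k' hle hk' => ?_, fun hfail => absurd rfl hfail, fun _ hinj => ?_⟩
  · rcases hle.eq_or_lt with rfl | hlt
    · exact hmem
    · exact h.ne_zero k' hlt hk'
  · obtain h0 | ⟨k', -, hk', hv, hx⟩ := h.entry (f k)
    · exact hmem h0
    · rw [hv, Nat.add_sub_cancel] at hf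
      exact hf (hinj hk'.mem_rowLetters hk.mem_rowLetters hx)

/-- Insert the border in `rBord`, whose successor is in `rCount`. -/
def insertBorder : Cmd :=
  .load rX rBord ;;
  .op .mul rPos rMul rX ;;
  .op .div rPos rPos rDiv ;;
  .op .add rPos rBase rPos ;;
  .load rEntry rPos ;;
  .ite (.eq rEntry rZero)
    (.store rPos rCount)
    (.op .sub rEntry rEntry rOne ;;
      .load rY rEntry ;;
      .ite (.eq rY rX) .skip (.const rFail 1))

theorem insertBorder_spec {hi m j k base : ℕ} {a D : Word w} {σ : State w} {f : ℕ → Word w}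
    (hm : m ≤ hi) (hhi : hi ≤ 2 ^ w) (hw : 0 < w) (hone : σ.reg rOne = 1) (hzero : σ.reg rZero = 0)
    (hf : ∀ i < m, σ.mem i = f i) (hbase : (σ.reg rBase).toNat = base) (hmb : m ≤ base)
    (ha : σ.reg rMul = a) (hD : σ.reg rDiv = D) (hfit : ∀ x, base + (hash a D x).toNat < hi)
    (hk : (σ.reg rBord).toNat = k) (hcount : (σ.reg rCount).toNat = k + 1)
    (hext : Extends f m j k) (hfill : Filled f m j (k + 1) base a D (σ.reg rFail) σ.mem) :
    Reach 0 hi insertBorder σ fun τ => (∀ d < 16, d ≠ rFail → τ.reg d = σ.reg d) ∧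
      (∀ p, (∀ x, p ≠ base + (hash a D x).toNat) → τ.mem p = σ.mem p) ∧
      Filled f m j k base a D (τ.reg rFail) τ.mem := by
  have h1 : (1#w).toNat = 1 := toNat_one (Nat.one_lt_two_pow hw.ne')
  have hkm : k < m := hext.1
  have hx : σ.mem k = f k := hf k hkm
  have hpos := hfit (f k)
  have haddr : (σ.reg rBase + a * f k / D).toNat = base + (hash a D (f k)).toNat := by
    rw [toNat_add_of_lt, hbase, hash]
    rw [hbase]
    exact hpos.trans_le hhi
  refine .seq (.load (by omega) (.seq (.op (.seq (.op (.seq (.op (.seq (.load ?_ ?_)))))))))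
  · simpa [Op.eval, hk, hx, ha, hD, haddr, -BitVec.toNat_add] using hpos
  have hsub : σ.mem (base + (hash a D (f k)).toNat) ≠ 0 →
      (σ.mem (base + (hash a D (f k)).toNat) - 1#w).toNat =
        (σ.mem (base + (hash a D (f k)).toNat)).toNat - 1 ∧
      (σ.mem (base + (hash a D (f k)).toNat)).toNat - 1 < m := by
    intro h0
    obtain h | ⟨k', -, hk', hv, -⟩ := hfill.entry (f k)
    · exact absurd h h0
    · rw [BitVec.toNat_sub_of_le (by rw [BitVec.le_def, h1]; omega), h1]
      exact ⟨rfl, by have := hk'.1; omega⟩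
  refine .ite (fun hc => .store ?_ ⟨fun d hd hd' => ?_, fun p hp => ?_, ?_⟩) (fun hc =>
    .seq (.op (.seq (.load ?_ (.ite (fun hc' => .skip ⟨fun d hd hd' => ?_, fun p hp => ?_, ?_⟩)
      (fun hc' => .const ⟨fun d hd hd' => ?_, fun p hp => ?_, ?_⟩))))))
  all_goals simp [Op.eval, hk, hx, ha, hD, haddr, hzero, Test.Holds, -BitVec.toNat_add,
      -BitVec.toNat_sub] at hc
  · simpa [Op.eval, hk, hx, ha, hD, haddr, -BitVec.toNat_add] using hpos
  · simp [show d ≠ rX by omega, show d ≠ rPos by omega, show d ≠ rEntry by omega]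
  · simp [Op.eval, hk, hx, ha, hD, haddr, hp, -BitVec.toNat_add]
  · convert hfill.insert_empty hext hc hcount using 1
    · simp
    · funext p
      simp [Op.eval, hk, hx, ha, hD, haddr, -BitVec.toNat_add]
  all_goals have hs := hsub hc
  all_goals have hy := hf _ hs.2
  all_goals try
    simp [Op.eval, hk, hx, ha, hD, haddr, hone, hs.1, hy, Test.Holds, -BitVec.toNat_add,
      -BitVec.toNat_sub] at hc'
  · simp [Op.eval, hk, hx, ha, hD, haddr, hone, hs.1, -BitVec.toNat_add, -BitVec.toNat_sub]
    exact hs.2.trans_le hm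
  · simp [show d ≠ rX by omega, show d ≠ rPos by omega, show d ≠ rEntry by omega,
      show d ≠ rY by omega]
  · rfl
  · simpa using hfill.insert_same hc hc'
  · simp [show d ≠ rX by omega, show d ≠ rPos by omega, show d ≠ rEntry by omega,
      show d ≠ rY by omega, hd']
  · rfl
  · simpa using hfill.insert_collision hext hc hc'

/-! ### The search for perfect hash functions -/

/-- Try to fill the table of the state in `rState`, with the hash function in `rMul` and `rDiv`. -/
def fillTable : Cmd :=
  clearTable ;;
  .const rFail 0 ;;
  .op .add rCount rState rOne ;;
  .loop (.lt rZero rCount) (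
    .op .sub rBord rCount rOne ;;
    .ite (.lt rBord rLen)
      (testBorder ;; .ite (.eq rOk rOne) insertBorder .skip)
      .skip ;;
    .op .add rCount rBord rZero)

theorem fillTable_spec {hi m j base T : ℕ} {a D : Word w} {σ : State w} {f : ℕ → Word w}
    (hhi : hi ≤ 2 ^ w) (hmw : m + 1 < 2 ^ w) (hone : σ.reg rOne = 1)
    (hzero : σ.reg rZero = 0) (hlen : (σ.reg rLen).toNat = m) (hf : ∀ i < m, σ.mem i = f i)
    (hj : (σ.reg rState).toNat = j) (hjm : j ≤ m) (hbase : (σ.reg rBase).toNat = base)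
    (hmb : m ≤ base) (hsize : (σ.reg rSize).toNat = T) (ha : σ.reg rMul = a) (hD : σ.reg rDiv = D)
    (hfit : base + T ≤ hi) (hhash : ∀ x, (hash a D x).toNat < T) :
    Reach 0 hi fillTable σ fun τ => Agree 13 σ τ ∧
      (∀ p, p < base ∨ base + T ≤ p → τ.mem p = σ.mem p) ∧
      Filled f m j 0 base a D (τ.reg rFail) τ.mem := by
  have hw : 0 < w := by
    rcases Nat.eq_zero_or_pos w with rfl | h
    · simp at hmw
    · exact h
  have h1 : (1#w).toNat = 1 := toNat_one (by omega)
  refine .seq ((clearTable_spec hhi hw hone hzero (by omega)).mono fun υ hυ => ?_)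
  obtain ⟨hag, hmem⟩ := hυ
  rw [hbase, hsize] at hmem
  have hcount : (σ.reg rState + 1#w).toNat = j + 1 := by
    rw [toNat_add_of_lt] <;> rw [hj, h1]
    omega
  have uj := hag rState (by decide)
  have uo := hag rOne (by decide)
  have uz := hag rZero (by decide)
  refine .seq (.const (.seq (.op (.loop (fun τ => Agree 13 σ τ ∧
    (∀ p, p < base ∨ base + T ≤ p → τ.mem p = σ.mem p) ∧ (τ.reg rCount).toNat ≤ j + 1 ∧
    Filled f m j (τ.reg rCount).toNat base a D (τ.reg rFail) τ.mem)
    (fun τ => (τ.reg rCount).toNat) ?_ ?_ ?_))))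
  · rintro τ ⟨hag, hmem, hle, hfill⟩ hc
    have tj := hag rState (by decide)
    have tone := hag rOne (by decide)
    have tz := hag rZero (by decide)
    have tl := hag rLen (by decide)
    have tb := hag rBase (by decide)
    have ta := hag rMul (by decide)
    have tD := hag rDiv (by decide)
    have hpos : 0 < (τ.reg rCount).toNat := by simpa [Test.Holds, tz, hzero] using hc
    obtain ⟨k, hk⟩ := Nat.exists_eq_succ_of_ne_zero hpos.ne'
    rw [Nat.succ_eq_add_one] at hk
    rw [hk] at hle hfill
    have hbord : (τ.reg rCount - 1#w).toNat = k := by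
      rw [BitVec.toNat_sub_of_le (by rw [BitVec.le_def]; omega), h1]
      omega
    have hmem' : ∀ i < m, τ.mem i = f i := fun i hi => by rw [hmem i (by omega), hf i hi]
    -- It suffices to process the border `k`.
    have final : ∀ υ : State w, (∀ d < 16, d ≠ rFail → d ≠ rBord → υ.reg d = τ.reg d) →
        (υ.reg rBord).toNat = k → (∀ p, p < base ∨ base + T ≤ p → υ.mem p = σ.mem p) →
        Filled f m j k base a D (υ.reg rFail) υ.mem →
        Reach 0 hi (.op .add rCount rBord rZero) υ fun υ => (Agree 13 σ υ ∧
          (∀ p, p < base ∨ base + T ≤ p → υ.mem p = σ.mem p) ∧ (υ.reg rCount).toNat ≤ j + 1 ∧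
          Filled f m j (υ.reg rCount).toNat base a D (υ.reg rFail) υ.mem) ∧
          (υ.reg rCount).toNat < (τ.reg rCount).toNat := by
      intro υ hreg hb hmem hfill
      have hz := hreg rZero (by decide) (by decide) (by decide)
      refine .op ⟨⟨fun d hd => ?_, hmem, ?_, ?_⟩, ?_⟩
      · simp [show d ≠ rCount by omega, hreg d (by omega) (by omega) (by omega), hag d hd]
      · simp [Op.eval, hz, tz, hzero, hb]
        omega
      · simpa [Op.eval, hz, tz, hzero, hb] using hfill
      · simp [Op.eval, hz, tz, hzero, hb, hk]
    refine .seq (.op (.seq (.ite (fun hkm => .seq ?_) fun hkm => .skip ?_)))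
    · have hkm : k < m := by simpa [Test.Holds, Op.eval, tone, hone, hbord, tl, hlen,
        -BitVec.toNat_sub] using hkm
      refine (testBorder_spec (hi := hi) (m := m) (f := f) (by omega) hw (by simp [tone, hone])
        (by simpa using hmem') (by simp [tj, hj, hjm]) ?_).mono ?_
      · simp [Op.eval, tone, hone, hbord, tj, hj, -BitVec.toNat_sub]
        omega
      rintro υ ⟨uag, umem, uok⟩
      have ureg : ∀ d < 17, d ≠ rBord → υ.reg d = τ.reg d := fun d hd hd' => by
        simp [uag d hd, hd']
      have ub : (υ.reg rBord).toNat = k := by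
        rw [uag rBord (by decide)]
        simp [Op.eval, tone, hone, hbord, -BitVec.toNat_sub]
      have umem : υ.mem = τ.mem := by simpa using umem
      have uok : υ.reg rOk = if IsBorder f k j then 1 else 0 := by
        simpa [Op.eval, tone, hone, hbord, tj, hj, -BitVec.toNat_sub] using uok
      have u2 := ureg rOne (by decide) (by decide)
      refine .ite (fun hc => ?_) fun hc => .skip (final υ ?_ ub ?_ ?_)
      · have hb : IsBorder f k j := by
          by_contra hb
          simp [Test.Holds, uok, hb, u2, tone, hone] at hc
          omega
        refine (insertBorder_spec (hi := hi) (m := m) (j := j) (k := k) (base := base) (a := a)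
          (D := D) (f := f) (by omega) hhi hw ?_ ?_ ?_ ?_ hmb ?_ ?_ ?_ ub ?_ ⟨hkm, hb⟩ ?_).mono ?_
        · rw [u2, tone, hone]
        · rw [ureg rZero (by decide) (by decide), tz, hzero]
        · rw [umem]
          exact hmem'
        · rw [ureg rBase (by decide) (by decide), tb, hbase]
        · rw [ureg rMul (by decide) (by decide), ta, ha]
        · rw [ureg rDiv (by decide) (by decide), tD, hD]
        · intro x
          have := hhash x
          omega
        · rw [ureg rCount (by decide) (by decide), hk]
        · rw [ureg rFail (by decide) (by decide), umem]
          exact hfill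
        · rintro φ ⟨preg, pmem, pfill⟩
          refine final φ (fun d hd hd' hd'' => ?_) ?_ (fun p hp => ?_) pfill
          · rw [preg d hd hd', ureg d (by omega) hd'']
          · rw [preg rBord (by decide) (by decide), ub]
          · rw [pmem p, umem, hmem p hp]
            intro x
            have := hhash x
            omega
      · exact fun d hd hd' hd'' => ureg d (by omega) hd''
      · rw [umem]
        exact hmem
      · rw [ureg rFail (by decide) (by decide), umem]
        refine hfill.skip fun hext => hc ?_
        simp [Test.Holds, uok, hext.2, u2, tone, hone]
    · have hkm : ¬ k < m := by simpa [Test.Holds, Op.eval, tone, hone, hbord, tl, hlen,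
        -BitVec.toNat_sub] using hkm
      refine final _ (fun d hd hd' hd'' => by simp [hd'']) ?_ (by simpa using hmem) ?_
      · simp [Op.eval, tone, hone, hbord, -BitVec.toNat_sub]
      · simpa using hfill.skip fun hext => hkm hext.1
  · rintro τ ⟨hag, hmem, hle, hfill⟩ hc
    refine ⟨hag, hmem, ?_⟩
    have : (τ.reg rCount).toNat = 0 := by
      have tz := hag rZero (by decide)
      simpa [Test.Holds, tz, hzero] using hc
    rwa [this] at hfill
  · refine ⟨fun d hd => ?_, fun p hp => ?_, ?_, ?_⟩
    · simp [show d ≠ rCount by omega, show d ≠ rFail by omega, hag d (by omega)]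
    · simp [hmem]
      omega
    · simp [Op.eval, uj, uo, hone, hcount, -BitVec.toNat_add]
    · have hcount' : (σ.reg rState + 1).toNat = j + 1 := hcount
      simp only [Op.eval, State.reg_setReg, State.mem_setReg, uj, uo, hone, hcount', reduceIte,
        Nat.reduceEqDiff]
      have hnone : ∀ k, j + 1 ≤ k → ¬ Extends f m j k := fun k hk hext => by
        have := hext.2.1
        omega
      refine ⟨fun x => .inl ?_, fun k hk hk' => absurd hk' (hnone k hk),
        fun _ k hk hk' => absurd hk' (hnone k hk), fun h => ?_⟩
      · have := hhash x
        simp [hmem]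
        omega
      · have := congrArg BitVec.toNat h
        simp at this
        omega

/-- Search a perfect hash function for the state in `rState`: try all multipliers for a table of
size `2`, then all multipliers for a table of size `4`, and so on. -/
def searchHash : Cmd :=
  .const rMul 0 ;;
  .const rSize 2 ;;
  .op .add rDiv rHalf rZero ;;
  .const rFail 1 ;;
  .loop (.eq rFail rOne) (
    fillTable ;;
    .ite (.eq rFail rOne)
      (.op .add rMul rMul rOne ;;
        .ite (.eq rMul rZero)
          (.op .add rSize rSize rSize ;;
            .const rX 2 ;;
            .op .div rDiv rDiv rX)
          .skip)
      .skip)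

/-- The search stops at the latest with the table size `2 ^ l₀` if a perfect hash function into a
table of this size exists. The attempts are enumerated by the number `l * 2 ^ w + a`, for the
multiplier `a` and the table size `2 ^ l`. -/
theorem searchHash_spec {hi m j base l₀ : ℕ} {a₀ : Word w} {σ : State w} {f : ℕ → Word w}
    (hhi : hi ≤ 2 ^ w) (hmw : m + 1 < 2 ^ w) (hw : 1 < w) (hone : σ.reg rOne = 1)
    (hzero : σ.reg rZero = 0) (hlen : (σ.reg rLen).toNat = m)
    (hhalf : σ.reg rHalf = BitVec.ofNat w (2 ^ (w - 1))) (hf : ∀ i < m, σ.mem i = f i)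
    (hj : (σ.reg rState).toNat = j) (hjm : j ≤ m) (hbase : (σ.reg rBase).toNat = base)
    (hmb : m ≤ base) (hl₀ : 0 < l₀) (hlw : l₀ < w) (hfit : base + 2 ^ l₀ ≤ hi)
    (hinj : Set.InjOn (hash a₀ (BitVec.ofNat w (2 ^ (w - l₀)))) (rowLetters f m j)) :
    Reach 0 hi searchHash σ fun τ => Agree 10 σ τ ∧
      (∀ p, p < base ∨ base + 2 ^ l₀ ≤ p → τ.mem p = σ.mem p) ∧
      ∃ l, 0 < l ∧ l ≤ l₀ ∧ (τ.reg rSize).toNat = 2 ^ l ∧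
        τ.reg rDiv = BitVec.ofNat w (2 ^ (w - l)) ∧ τ.reg rFail ≠ 1 ∧
        Filled f m j 0 base (τ.reg rMul) (τ.reg rDiv) (τ.reg rFail) τ.mem := by
  have h2w : 2 < 2 ^ w := by
    calc 2 = 2 ^ 1 := rfl
      _ < 2 ^ w := Nat.pow_lt_pow_right (by norm_num) hw
  have h1 : (1#w).toNat = 1 := toNat_one (by omega)
  have h2 : (2#w).toNat = 2 := toNat_ofNat_of_lt h2w
  have ha₀ := a₀.isLt
  refine .seq (.const (.seq (.const (.seq (.op (.seq (.const (.loop (fun τ => Agree 10 σ τ ∧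
    (∀ p, p < base ∨ base + 2 ^ l₀ ≤ p → τ.mem p = σ.mem p) ∧
      ∃ l, 0 < l ∧ (τ.reg rSize).toNat = 2 ^ l ∧
        τ.reg rDiv = BitVec.ofNat w (2 ^ (w - l)) ∧
        l * 2 ^ w + (τ.reg rMul).toNat ≤ l₀ * 2 ^ w + a₀.toNat ∧
        (τ.reg rFail ≠ 1 →
          Filled f m j 0 base (τ.reg rMul) (τ.reg rDiv) (τ.reg rFail) τ.mem))
    (fun τ => 2 * (l₀ * 2 ^ w + a₀.toNat -
      (Nat.log 2 (τ.reg rSize).toNat * 2 ^ w + (τ.reg rMul).toNat)) +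
        if τ.reg rFail = 1 then 1 else 0) ?_ ?_ ?_))))))))
  · rintro τ ⟨hag, hmem, l, hl, hsize, hdiv, hrank, -⟩ hc
    have tone := hag rOne (by decide)
    have tz := hag rZero (by decide)
    have hc : τ.reg rFail = 1 := by simpa [Test.Holds, tone, hone] using hc
    have ha := (τ.reg rMul).isLt
    have hll : l ≤ l₀ := by
      by_contra! h
      have : (l₀ + 1) * 2 ^ w ≤ l * 2 ^ w := Nat.mul_le_mul_right _ h
      rw [add_mul] at this
      omega
    have hpow : 2 ^ l ≤ 2 ^ l₀ := Nat.pow_le_pow_right (by norm_num) hll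
    refine .seq ((fillTable_spec (m := m) (j := j) (base := base) (T := 2 ^ l) (f := f) hhi hmw
      (by rw [tone, hone]) (by rw [tz, hzero]) (by rw [hag rLen (by decide), hlen])
      (fun i hi => by rw [hmem i (by omega), hf i hi]) (by rw [hag rState (by decide), hj]) hjm
      (by rw [hag rBase (by decide), hbase]) hmb hsize rfl hdiv (by omega)
      (toNat_hash_lt hl (by omega) _)).mono fun υ hυ => ?_)
    obtain ⟨uag, umem, ufill⟩ := hυ
    have umul := uag rMul (by decide)
    have udiv := uag rDiv (by decide)
    have usize := uag rSize (by decide)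
    have uone := uag rOne (by decide)
    have uz := uag rZero (by decide)
    have umem' : ∀ p, p < base ∨ base + 2 ^ l₀ ≤ p → υ.mem p = σ.mem p := fun p hp => by
      rw [umem p (by omega), hmem p hp]
    -- A failing attempt is not the attempt that is known to be successful.
    have hstrict : υ.reg rFail = 1 → l * 2 ^ w + (τ.reg rMul).toNat < l₀ * 2 ^ w + a₀.toNat := by
      refine fun hc' => lt_of_le_of_ne hrank fun heq => ufill.collision hc' ?_
      have hl : l = l₀ := by
        by_contra h
        have : (l + 1) * 2 ^ w ≤ l₀ * 2 ^ w := Nat.mul_le_mul_right _ (by omega)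
        rw [add_mul] at this
        omega
      subst hl
      rw [BitVec.eq_of_toNat_eq (Nat.add_left_cancel heq)]
      exact hinj
    refine .ite (fun hc' => .seq (.op (.ite (fun hwrap => .seq (.op (.seq (.const (.op ?_)))))
      fun hwrap => .skip ?_))) (fun hc' => .skip ?_)
    all_goals simp only [Test.Holds, uone, tone, hone] at hc'
    · have hlt := hstrict hc'
      have hwrap : τ.reg rMul + 1 = 0 := by
        simpa [Test.Holds, Op.eval, uone, tone, hone, uz, tz, hzero, umul] using hwrap
      have hmax : (τ.reg rMul).toNat + 1 = 2 ^ w := by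
        by_contra h
        have h' : (τ.reg rMul + 1#w).toNat = (τ.reg rMul).toNat + 1 := by
          rw [toNat_add_of_lt] <;> rw [h1]
          omega
        rw [show τ.reg rMul + 1#w = 0#w from hwrap] at h'
        simp at h'
      have hll' : l < l₀ := by
        refine lt_of_le_of_ne hll fun h => ?_
        subst h
        omega
      have hp : 2 ^ (l + 1) < 2 ^ w := Nat.pow_lt_pow_right (by norm_num) (by omega)
      have hsize' : (υ.reg rSize + υ.reg rSize).toNat = 2 ^ (l + 1) := by
        rw [toNat_add_of_lt] <;> rw [usize, hsize]
        · ring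
        · rw [← two_mul, ← pow_succ']
          exact hp
      have hdiv' : υ.reg rDiv / 2#w = BitVec.ofNat w (2 ^ (w - (l + 1))) := by
        apply BitVec.eq_of_toNat_eq
        rw [udiv, hdiv, BitVec.toNat_udiv, h2,
          toNat_ofNat_of_lt (Nat.pow_lt_pow_right (by norm_num) (by omega)),
          toNat_ofNat_of_lt (Nat.pow_lt_pow_right (by norm_num) (by omega)),
          show w - l = w - (l + 1) + 1 by omega, pow_succ, Nat.mul_div_cancel _ (by norm_num)]
      have hrank' : (l + 1) * 2 ^ w = l * 2 ^ w + (τ.reg rMul).toNat + 1 := by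
        rw [add_mul]
        omega
      refine ⟨⟨fun d hd => ?_, by simpa using umem', l + 1, by omega, ?_, ?_, ?_, ?_⟩, ?_⟩
      · simp [show d ≠ rMul by omega, show d ≠ rDiv by omega, show d ≠ rSize by omega,
          show d ≠ rX by omega, hag.trans uag (by decide) d hd]
      · simpa [Op.eval, -BitVec.toNat_add] using hsize'
      · simpa [Op.eval] using hdiv'
      · simp [Op.eval, uone, tone, hone, umul, show τ.reg rMul + 1#w = 0#w from hwrap, hrank',
          -BitVec.toNat_add]
        omega
      · simp [hc']
      · simp [Op.eval, uone, tone, hone, umul, show τ.reg rMul + 1#w = 0#w from hwrap,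
          hsize', hsize, hc, hc', -BitVec.toNat_add]
        rw [hrank']
        omega
    · have hlt := hstrict hc'
      have hwrap : ¬ τ.reg rMul + 1#w = 0#w := by
        simpa [Test.Holds, Op.eval, uone, tone, hone, uz, tz, hzero, umul] using hwrap
      have hinc : (τ.reg rMul + 1#w).toNat = (τ.reg rMul).toNat + 1 := by
        rw [toNat_add_of_lt] <;> rw [h1]
        by_contra h
        apply hwrap
        apply BitVec.eq_of_toNat_eq
        rw [BitVec.toNat_add, h1, show (τ.reg rMul).toNat + 1 = 2 ^ w by omega]
        simp
      refine ⟨⟨fun d hd => ?_, by simpa using umem', l, hl, ?_, ?_, ?_, ?_⟩, ?_⟩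
      · simp [show d ≠ rMul by omega, hag.trans uag (by decide) d hd]
      · simp [usize, hsize]
      · simp [udiv, hdiv]
      · simp [Op.eval, uone, tone, hone, umul, hinc, -BitVec.toNat_add]
        omega
      · simp [hc']
      · simp [Op.eval, uone, tone, hone, umul, usize, hinc, hsize, hc, hc', -BitVec.toNat_add]
        omega
    · refine ⟨⟨hag.trans uag (by decide), umem', l, hl, ?_, ?_, ?_, fun _ => ?_⟩, ?_⟩
      · rw [usize, hsize]
      · rw [udiv, hdiv]
      · rwa [umul]
      · rwa [umul, udiv, hdiv]
      · rw [usize, umul, hc, if_pos rfl, if_neg hc']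
        omega
  · rintro τ ⟨hag, hmem, l, hl, hsize, hdiv, hrank, hfill⟩ hc
    have hc : τ.reg rFail ≠ 1 := by simpa [Test.Holds, hag rOne (by decide), hone] using hc
    have ha := (τ.reg rMul).isLt
    have hll : l ≤ l₀ := by
      by_contra! h
      have : (l₀ + 1) * 2 ^ w ≤ l * 2 ^ w := Nat.mul_le_mul_right _ h
      rw [add_mul] at this
      omega
    exact ⟨hag, hmem, l, hl, hll, hsize, hdiv, hc, hfill hc⟩
  · refine ⟨fun d hd => ?_, fun p _ => by simp, 1, one_pos, ?_, ?_, ?_, ?_⟩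
    · simp [show d ≠ rMul by omega, show d ≠ rDiv by omega, show d ≠ rSize by omega,
        show d ≠ rFail by omega]
    · simpa using h2
    · simp [Op.eval, hhalf, hzero]
    · have : 1 * 2 ^ w ≤ l₀ * 2 ^ w := Nat.mul_le_mul_right _ hl₀
      simp
      omega
    · simp

/-! ### The transition tables -/

/-- The cell in which the automaton looks up the letter `x` in state `j`. The multipliers, the
divisors and the table addresses of the states are in three arrays of `rows` cells each, which start
at the addresses `rows`, `2 * rows` and `3 * rows`. -/
def cell (mem : ℕ → Word w) (rows j : ℕ) (x : Word w) : ℕ :=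
  (mem (3 * rows + j)).toNat + (hash (mem (rows + j)) (mem (2 * rows + j)) x).toNat

/-- The transitions of state `j` of the matching automaton of `P` can be looked up in the memory,
and the cells used for this have addresses below `top`. -/
structure RowOK (P : List (Word w)) (mem : ℕ → Word w) (top j : ℕ) : Prop where
  le_cell : ∀ x, 4 * (P.length + 1) ≤ cell mem (P.length + 1) j x
  cell_lt : ∀ x, cell mem (P.length + 1) j x < top
  entry_le : ∀ x, (mem (cell mem (P.length + 1) j x)).toNat ≤ P.length
  matchLen_eq : ∀ x, matchLen P (P.take j ++ [x]) =
    if mem (cell mem (P.length + 1) j x) ≠ 0 ∧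
      P.getD ((mem (cell mem (P.length + 1) j x)).toNat - 1) 0 = x
    then (mem (cell mem (P.length + 1) j x)).toNat else 0

theorem RowOK.congr {P : List (Word w)} {mem mem' : ℕ → Word w} {top top' j : ℕ}
    (h : RowOK P mem top j) (htop : top ≤ top')
    (h1 : mem' (P.length + 1 + j) = mem (P.length + 1 + j))
    (h2 : mem' (2 * (P.length + 1) + j) = mem (2 * (P.length + 1) + j))
    (h3 : mem' (3 * (P.length + 1) + j) = mem (3 * (P.length + 1) + j))
    (h4 : ∀ p, 4 * (P.length + 1) ≤ p → p < top → mem' p = mem p) : RowOK P mem' top' j := by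
  have hc : ∀ x, cell mem' (P.length + 1) j x = cell mem (P.length + 1) j x := fun x => by
    simp only [cell, h1, h2, h3]
  have hm : ∀ x, mem' (cell mem (P.length + 1) j x) = mem (cell mem (P.length + 1) j x) :=
    fun x => h4 _ (h.le_cell x) (h.cell_lt x)
  refine ⟨fun x => ?_, fun x => ?_, fun x => ?_, fun x => ?_⟩
  · rw [hc]
    exact h.le_cell x
  · rw [hc]
    exact (h.cell_lt x).trans_le htop
  · rw [hc, hm]
    exact h.entry_le x
  · rw [hc, hm]
    exact h.matchLen_eq x

/-- A completely filled table without collisions represents the transitions of a state. -/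
theorem Filled.rowOK {P : List (Word w)} {mem : ℕ → Word w} {j base top : ℕ} {a D fail : Word w}
    (h : Filled (fun i => P.getD i 0) P.length j 0 base a D fail mem) (hfail : fail ≠ 1)
    (hj : j ≤ P.length) (h1 : mem (P.length + 1 + j) = a) (h2 : mem (2 * (P.length + 1) + j) = D)
    (h3 : (mem (3 * (P.length + 1) + j)).toNat = base) (hbase : 4 * (P.length + 1) ≤ base)
    (htop : ∀ x, base + (hash a D x).toNat < top) : RowOK P mem top j := by
  have hc : ∀ x, cell mem (P.length + 1) j x = base + (hash a D x).toNat := fun x => by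
    simp only [cell, h1, h2, h3]
  refine ⟨fun x => ?_, fun x => ?_, fun x => ?_, fun x => ?_⟩
  · rw [hc]
    omega
  · rw [hc]
    exact htop x
  · rw [hc]
    obtain h0 | ⟨k, -, hk, hv, -⟩ := h.entry x
    · simp [h0]
    · rw [hv]
      exact hk.1
  · rw [hc]
    obtain h0 | ⟨k, -, hk, hv, hx⟩ := h.entry x
    · rw [if_neg (by simp [h0])]
      refine matchLen_take_append_eq_zero P 0 x hj fun k hk hb hkx => ?_
      have := h.ne_zero k (Nat.zero_le _) ⟨hk, hb⟩
      simp only [hkx] at this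
      exact this h0
    · have hne : mem (base + (hash a D x).toNat) ≠ 0 := fun h0 => by simp [h0] at hv
      by_cases hkx : P.getD k 0 = x
      · rw [if_pos ⟨hne, by rw [hv, Nat.add_sub_cancel, hkx]⟩, hv]
        refine matchLen_take_append_eq_succ P 0 x hj hk.1 hk.2 hkx fun k' hk' hb hkx' => ?_
        have := (h.longest hfail k' (Nat.zero_le _) ⟨hk', hb⟩).2
        simp only [hkx', hv] at this
        omega
      · rw [if_neg (by rw [hv, Nat.add_sub_cancel]; exact fun h => hkx h.2)]
        refine matchLen_take_append_eq_zero P 0 x hj fun k' hk' hb hkx' => ?_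
        have := (h.longest hfail k' (Nat.zero_le _) ⟨hk', hb⟩).1
        simp only [hkx', hv, Nat.add_sub_cancel] at this
        exact hkx this

/-- The binary logarithm of a table size that suffices for state `j`. -/
def tableBits (f : ℕ → Word w) (m j : ℕ) : ℕ := Nat.log 2 (4 * (rowLetters f m j).card ^ 2) + 1

theorem lt_two_pow_tableBits (f : ℕ → Word w) (m j : ℕ) :
    4 * (rowLetters f m j).card ^ 2 < 2 ^ tableBits f m j :=
  Nat.lt_pow_succ_log_self (by norm_num) _

theorem two_pow_tableBits_le (f : ℕ → Word w) (m j : ℕ) :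
    2 ^ tableBits f m j ≤ 8 * (rowLetters f m j).card ^ 2 + 2 := by
  rw [tableBits, pow_succ]
  rcases Nat.eq_zero_or_pos (4 * (rowLetters f m j).card ^ 2) with h | h
  · simp [h]
  · have := Nat.pow_log_le_self 2 h.ne'
    omega

/-- The total size of the tables is linear. -/
theorem sum_two_pow_tableBits_le (f : ℕ → Word w) (m : ℕ) :
    ∑ j ∈ Finset.range (m + 1), 2 ^ tableBits f m j ≤ 842 * (m + 1) := by
  have h := sum_sq_card_rowLetters_le (f := f) m
  calc _ ≤ ∑ j ∈ Finset.range (m + 1), (8 * (rowLetters f m j).card ^ 2 + 2) :=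
        Finset.sum_le_sum fun j _ => two_pow_tableBits_le f m j
    _ = 8 * ∑ j ∈ Finset.range (m + 1), (rowLetters f m j).card ^ 2 + 2 * (m + 1) := by
        rw [Finset.sum_add_distrib, ← Finset.mul_sum, Finset.sum_const, Finset.card_range,
          smul_eq_mul, mul_comm 2]
    _ ≤ _ := by omega

/-- Build the table of the state in `rState` and store its parameters. -/
def buildRow : Cmd :=
  searchHash ;;
  .op .add rPos rRows rState ;;
  .store rPos rMul ;;
  .op .add rPos rPos rRows ;;
  .store rPos rDiv ;;
  .op .add rPos rPos rRows ;;
  .store rPos rBase ;;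
  .op .add rBase rBase rSize ;;
  .op .add rState rState rOne

theorem buildRow_spec {hi j base : ℕ} {P : List (Word w)} {σ : State w} {l₀ : ℕ}
    (hl₀ : l₀ = tableBits (fun i => P.getD i 0) P.length j)
    (hhi : hi ≤ 2 ^ w) (hone : σ.reg rOne = 1)
    (hzero : σ.reg rZero = 0) (hlen : (σ.reg rLen).toNat = P.length)
    (hrows : (σ.reg rRows).toNat = P.length + 1)
    (hhalf : σ.reg rHalf = BitVec.ofNat w (2 ^ (w - 1)))
    (hf : ∀ i < P.length, σ.mem i = P.getD i 0)
    (hj : (σ.reg rState).toNat = j) (hjm : j ≤ P.length) (hbase : (σ.reg rBase).toNat = base)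
    (hmb : 4 * (P.length + 1) ≤ base) (hfit : base + 2 ^ l₀ < hi)
    (hrow : ∀ i < j, RowOK P σ.mem base i) :
    Reach 0 hi buildRow σ fun τ => Agree 8 σ τ ∧ (τ.reg rState).toNat = j + 1 ∧
      base ≤ (τ.reg rBase).toNat ∧ (τ.reg rBase).toNat ≤ base + 2 ^ l₀ ∧
      (∀ i < P.length, τ.mem i = P.getD i 0) ∧
      ∀ i < j + 1, RowOK P τ.mem (τ.reg rBase).toNat i := by
  have hl0 : 0 < l₀ := by rw [hl₀]; exact Nat.succ_pos _
  have hlw : l₀ < w := (Nat.pow_lt_pow_iff_right (show 1 < 2 by norm_num)).1 (by omega)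
  have h1 : (1#w).toNat = 1 := toNat_one (by omega)
  obtain ⟨a₀, ha₀⟩ := exists_injOn_hash (rowLetters (fun i => P.getD i 0) P.length j) hl0 hlw.le
    (by rw [hl₀]; exact lt_two_pow_tableBits _ _ _)
  refine .seq ((searchHash_spec (m := P.length) (j := j) (base := base) (l₀ := l₀) (a₀ := a₀)
    (f := fun i => P.getD i 0) hhi (by omega) (by omega) hone hzero hlen hhalf hf hj hjm hbase
    (by omega) hl0 hlw hfit.le ha₀).mono fun υ hυ => ?_)
  obtain ⟨hag, hmem, l, hl, hll, hsize, hdiv, hfail, hfill⟩ := hυ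
  have hpow : 2 ^ l ≤ 2 ^ l₀ := Nat.pow_le_pow_right (by norm_num) hll
  have uj := hag rState (by decide)
  have ur := hag rRows (by decide)
  have uo := hag rOne (by decide)
  have ub := hag rBase (by decide)
  have p1 : (σ.reg rRows + σ.reg rState).toNat = P.length + 1 + j := by
    rw [toNat_add_of_lt] <;> rw [hrows, hj]
    omega
  have p2 : (σ.reg rRows + σ.reg rState + σ.reg rRows).toNat = 2 * (P.length + 1) + j := by
    rw [toNat_add_of_lt] <;> rw [p1, hrows]
    · omega
    · omega
  have p3 : (σ.reg rRows + σ.reg rState + σ.reg rRows + σ.reg rRows).toNat =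
      3 * (P.length + 1) + j := by
    rw [toNat_add_of_lt] <;> rw [p2, hrows]
    · omega
    · omega
  have pb : (σ.reg rBase + υ.reg rSize).toNat = base + 2 ^ l := by
    rw [toNat_add_of_lt] <;> rw [hbase, hsize]
    omega
  have pj : (σ.reg rState + 1#w).toNat = j + 1 := by
    rw [toNat_add_of_lt] <;> rw [hj, h1]
    omega
  refine .seq (.op (.seq (.store ?_ (.seq (.op (.seq (.store ?_ (.seq (.op (.seq (.store ?_
    (.seq (.op (.op ?_))))))))))))))
  · simp [Op.eval, uj, ur, p1, -BitVec.toNat_add]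
    omega
  · simp [Op.eval, uj, ur, p2, -BitVec.toNat_add]
    omega
  · simp [Op.eval, uj, ur, p3, -BitVec.toNat_add]
    omega
  have key : ∀ mem : ℕ → Word w, (∀ p, mem p = if p = 3 * (P.length + 1) + j then σ.reg rBase
      else if p = 2 * (P.length + 1) + j then υ.reg rDiv
      else if p = P.length + 1 + j then υ.reg rMul else υ.mem p) →
      (∀ i < P.length, mem i = P.getD i 0) ∧ ∀ i < j + 1, RowOK P mem (base + 2 ^ l) i := by
    intro mem hm
    have hold : ∀ p, p ≠ P.length + 1 + j → p ≠ 2 * (P.length + 1) + j →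
        p ≠ 3 * (P.length + 1) + j → p < base → mem p = σ.mem p := by
      intro p h1 h2 h3 hp
      rw [hm, if_neg h3, if_neg h2, if_neg h1, hmem p (.inl hp)]
    have htable : ∀ p, base ≤ p → mem p = υ.mem p := fun p hp => by
      rw [hm, if_neg (by omega), if_neg (by omega), if_neg (by omega)]
    refine ⟨fun i hi => ?_, fun i hi => ?_⟩
    · rw [hold i (by omega) (by omega) (by omega) (by omega), hf i hi]
    · rcases Nat.lt_succ_iff_lt_or_eq.1 hi with hi | rfl
      · refine (hrow i hi).congr (by omega) ?_ ?_ ?_ fun p hp hp' => ?_ <;>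
          exact hold _ (by omega) (by omega) (by omega) (by omega)
      · have hfill' : Filled (fun i => P.getD i 0) P.length i 0 base (υ.reg rMul) (υ.reg rDiv)
            (υ.reg rFail) mem := by
          refine ⟨fun x => ?_, fun k hk hext => ?_, fun h k hk hext => ?_, hfill.collision⟩
          · rw [htable _ (by omega)]
            exact hfill.entry x
          · rw [htable _ (by omega)]
            exact hfill.ne_zero k hk hext
          · rw [htable _ (by omega)]
            exact hfill.longest h k hk hext
        refine hfill'.rowOK hfail hjm ?_ ?_ ?_ hmb fun x => ?_
        · rw [hm, if_neg (by omega), if_neg (by omega), if_pos rfl]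
        · rw [hm, if_neg (by omega), if_pos rfl]
        · rw [hm, if_pos rfl, hbase]
        · have := toNat_hash_lt hl (show l ≤ w by omega) (υ.reg rMul) x
          rw [hdiv]
          omega
  refine ⟨fun d hd => ?_, ?_, ?_, ?_, ?_⟩
  · simp [show d ≠ rPos by omega, show d ≠ rBase by omega, show d ≠ rState by omega,
      hag d (by omega)]
  · simpa [Op.eval, uj, uo, hone, -BitVec.toNat_add] using pj
  · simp [Op.eval, ub, pb, -BitVec.toNat_add]
  · simp [Op.eval, ub, pb, -BitVec.toNat_add]
    exact hpow
  · simp only [Op.eval, State.reg_setReg, State.reg_setMem, reduceIte, Nat.reduceEqDiff, ub, pb]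
    refine key _ fun p => ?_
    simp [uj, ur, p1, p2, p3, -BitVec.toNat_add]

/-- Build the tables of all states. -/
def buildTables : Cmd :=
  .loop (.lt rState rRows) buildRow

theorem buildTables_spec {hi : ℕ} {P : List (Word w)} {σ : State w}
    (hhi : hi ≤ 2 ^ w) (hone : σ.reg rOne = 1)
    (hzero : σ.reg rZero = 0) (hlen : (σ.reg rLen).toNat = P.length)
    (hrows : (σ.reg rRows).toNat = P.length + 1)
    (hhalf : σ.reg rHalf = BitVec.ofNat w (2 ^ (w - 1)))
    (hf : ∀ i < P.length, σ.mem i = P.getD i 0)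
    (hj : σ.reg rState = 0) (hbase : (σ.reg rBase).toNat = 4 * (P.length + 1))
    (hfit : 846 * (P.length + 1) < hi) :
    Reach 0 hi buildTables σ fun τ => Agree 8 σ τ ∧ (∀ i < P.length, τ.mem i = P.getD i 0) ∧
      ∀ i ≤ P.length, RowOK P τ.mem hi i := by
  set size : ℕ → ℕ := fun j => 2 ^ tableBits (fun i => P.getD i 0) P.length j with hsize
  have hsum : ∀ j ≤ P.length, ∑ i ∈ Finset.range (j + 1), size i ≤ 842 * (P.length + 1) :=
    fun j hj => (Finset.sum_le_sum_of_subset (Finset.range_mono (by omega))).trans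
      (sum_two_pow_tableBits_le _ _)
  refine .loop (fun τ => Agree 8 σ τ ∧ (τ.reg rState).toNat ≤ P.length + 1 ∧
    4 * (P.length + 1) ≤ (τ.reg rBase).toNat ∧
    (τ.reg rBase).toNat ≤ 4 * (P.length + 1) +
      ∑ i ∈ Finset.range (τ.reg rState).toNat, size i ∧
    (∀ i < P.length, τ.mem i = P.getD i 0) ∧
    ∀ i < (τ.reg rState).toNat, RowOK P τ.mem (τ.reg rBase).toNat i)
    (fun τ => P.length + 1 - (τ.reg rState).toNat) ?_ ?_ ?_
  · rintro τ ⟨hag, hj, hb, hb', hmem, hrow⟩ hc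
    have tr := hag rRows (by decide)
    have hlt : (τ.reg rState).toNat < P.length + 1 := by
      simpa only [Test.Holds, tr, hrows] using hc
    have hs := hsum (τ.reg rState).toNat (by omega)
    rw [Finset.sum_range_succ] at hs
    refine (buildRow_spec (j := (τ.reg rState).toNat) (base := (τ.reg rBase).toNat) (P := P)
      rfl hhi (by rw [hag rOne (by decide), hone]) (by rw [hag rZero (by decide), hzero])
      (by rw [hag rLen (by decide), hlen]) (by rw [tr, hrows])
      (by rw [hag rHalf (by decide), hhalf]) hmem rfl (by omega) rfl hb
      (by change _ + size _ < hi; omega) hrow).mono ?_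
    rintro υ ⟨uag, uj, ub, ub', umem, urow⟩
    refine ⟨⟨hag.trans uag le_rfl, by omega, by omega, ?_, umem, by rwa [uj]⟩, by omega⟩
    rw [uj, Finset.sum_range_succ]
    change _ ≤ _ + size _ at ub'
    omega
  · rintro τ ⟨hag, hj, hb, hb', hmem, hrow⟩ hc
    have tr := hag rRows (by decide)
    have heq : (τ.reg rState).toNat = P.length + 1 := by
      have : ¬ (τ.reg rState).toNat < P.length + 1 := by
        simpa only [Test.Holds, tr, hrows] using hc
      omega
    have hs := hsum P.length le_rfl
    rw [heq] at hb' hrow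
    exact ⟨hag, hmem, fun i hi => (hrow i (by omega)).congr (by omega) rfl rfl rfl fun _ _ _ => rfl⟩
  · simp only [hj]
    refine ⟨fun _ _ => rfl, by simp, hbase.ge, by simp [hbase], hf, by simp⟩

/-- The preprocessing program: it sets up the constants and builds the tables of the automaton.
For a pattern of length `m` the parameters and tables of the states end before the address
`846 * (m + 1) < 2048 * m`. -/
def preprocess : Cmd :=
  .const rOne 1 ;;
  .const rZero 0 ;;
  .op .add rLen 0 rZero ;;
  .op .add rRows rLen rOne ;;
  .op .add rBase rRows rRows ;;
  .op .add rBase rBase rBase ;;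
  .const rX 2048 ;;
  .op .mul rStreams rX rLen ;;
  .op .sub rHalf rZero rOne ;;
  .const rX 2 ;;
  .op .div rHalf rHalf rX ;;
  .op .add rHalf rHalf rOne ;;
  .const rState 0 ;;
  buildTables

/-- The data that the preprocessing leaves for the online phase. -/
structure Ready (P : List (Word w)) (σ : State w) : Prop where
  len : (σ.reg rLen).toNat = P.length
  rows : (σ.reg rRows).toNat = P.length + 1
  streams : σ.reg rStreams = BitVec.ofNat w (2048 * P.length)
  one : σ.reg rOne = 1
  zero : σ.reg rZero = 0
  letter : ∀ i < P.length, σ.mem i = P.getD i 0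
  row : ∀ j ≤ P.length, RowOK P σ.mem (2048 * P.length) j

theorem preprocess_spec {P : List (Word w)} (hP : P ≠ []) (hm : 2048 * P.length ≤ 2 ^ w) :
    Reach 0 (2048 * P.length) preprocess (initState P) (Ready P) := by
  have hm0 : 0 < P.length := List.length_pos_iff.2 hP
  have hw : 1 < w := by
    by_contra! h
    have : 2 ^ w ≤ 2 ^ 1 := Nat.pow_le_pow_right (by norm_num) h
    omega
  have h1 : (1#w).toNat = 1 := toNat_one (by omega)
  have h2 : (2#w).toNat = 2 := toNat_ofNat_of_lt (by omega)
  have hlen : (BitVec.ofNat w P.length).toNat = P.length := toNat_ofNat_of_lt (by omega)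
  have hrows : (BitVec.ofNat w P.length + 1#w).toNat = P.length + 1 := by
    rw [toNat_add_of_lt] <;> rw [hlen, h1]
    omega
  have hrows2 : (BitVec.ofNat w P.length + 1#w + (BitVec.ofNat w P.length + 1#w)).toNat =
      2 * (P.length + 1) := by
    rw [toNat_add_of_lt] <;> rw [hrows] <;> omega
  have hrows4 : (BitVec.ofNat w P.length + 1#w + (BitVec.ofNat w P.length + 1#w) +
      (BitVec.ofNat w P.length + 1#w + (BitVec.ofNat w P.length + 1#w))).toNat =
      4 * (P.length + 1) := by
    rw [toNat_add_of_lt] <;> rw [hrows2] <;> omega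
  have hhalf : (0#w - 1#w) / 2#w + 1#w = BitVec.ofNat w (2 ^ (w - 1)) := by
    have hpow : 2 ^ w = 2 * 2 ^ (w - 1) := by rw [← pow_succ', Nat.sub_add_cancel (by omega)]
    have hdiv : ((0#w - 1#w) / 2#w).toNat = 2 ^ (w - 1) - 1 := by
      rw [BitVec.toNat_udiv, h2, BitVec.toNat_sub, h1, BitVec.toNat_ofNat, Nat.zero_mod, add_zero,
        Nat.mod_eq_of_lt (by omega)]
      omega
    apply BitVec.eq_of_toNat_eq
    rw [toNat_add_of_lt, hdiv, h1, toNat_ofNat_of_lt (by omega)]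
    · omega
    · rw [hdiv, h1]
      omega
  refine .seq (.const (.seq (.const (.seq (.op (.seq (.op (.seq (.op (.seq (.op (.seq (.const
    (.seq (.op (.seq (.op (.seq (.const (.seq (.op (.seq (.op (.seq (.const
    ((buildTables_spec (P := P) hm ?_ ?_ ?_ ?_ ?_ ?_ ?_ ?_ ?_).mono
      ?_))))))))))))))))))))))))))
  · simp
  · simp
  · simpa [Op.eval, initState, -BitVec.toNat_add] using hlen
  · simpa [Op.eval, initState, -BitVec.toNat_add] using hrows
  · simpa [Op.eval, initState, -BitVec.toNat_add] using hhalf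
  · intro i hi
    simp [initState]
  · simp
  · simpa [Op.eval, initState, -BitVec.toNat_add] using hrows4
  · omega
  · rintro τ ⟨hag, hmem, hrow⟩
    refine ⟨?_, ?_, ?_, ?_, ?_, hmem, hrow⟩
    · rw [hag rLen (by decide)]
      simpa [Op.eval, initState, -BitVec.toNat_add] using hlen
    · rw [hag rRows (by decide)]
      simpa [Op.eval, initState, -BitVec.toNat_add] using hrows
    · rw [hag rStreams (by decide)]
      simp [Op.eval, initState, BitVec.ofNat_mul]
    · rw [hag rOne (by decide)]
      simp
    · rw [hag rZero (by decide)]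
      simp

/-! ### The online program -/

/-- The program contains no loop. -/
def Cmd.LoopFree : Cmd → Prop
  | .seq p q => p.LoopFree ∧ q.LoopFree
  | .ite _ p q => p.LoopFree ∧ q.LoopFree
  | .loop _ _ => False
  | _ => True

/-- The maximal number of steps of a program without loops. -/
def Cmd.steps : Cmd → ℕ
  | .seq p q => p.steps + q.steps
  | .ite _ p q => 1 + max p.steps q.steps
  | _ => 1

theorem Exec.le_steps {lo hi : ℕ} {p : Cmd} {σ τ : State w} {t : ℕ} (h : Exec lo hi p σ t τ)
    (hp : p.LoopFree) : t ≤ p.steps := by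
  induction h with
  | skip | const | op | load | store => exact le_rfl
  | seq _ _ ih₁ ih₂ => exact add_le_add (ih₁ hp.1) (ih₂ hp.2)
  | ite_true _ _ ih => exact add_le_add le_rfl ((ih hp.1).trans (le_max_left _ _))
  | ite_false _ _ ih => exact add_le_add le_rfl ((ih hp.2).trans (le_max_right _ _))
  | loop_stop | loop_step => exact hp.elim

/-- Load the table entry for the letter in register `1` and the current state of the stream with the
index in register `0`. -/
def loadEntry : Cmd :=
  .op .add rIdx rStreams 0 ;;
  .load rState rIdx ;;
  .op .add rPos rRows rState ;;
  .load rMul rPos ;;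
  .op .add rPos rPos rRows ;;
  .load rDiv rPos ;;
  .op .add rPos rPos rRows ;;
  .load rBase rPos ;;
  .op .mul rX rMul 1 ;;
  .op .div rX rX rDiv ;;
  .op .add rPos rBase rX ;;
  .load rEntry rPos

/-- Process the arrival of the letter in register `1` in the stream with the index in register
`0`: look up the transition of the automaton, check that the entry found belongs to this letter,
and go to state `0` otherwise. -/
def processArrival : Cmd :=
  loadEntry ;;
  .ite (.eq rEntry rZero) .skip
    (.op .sub rPos rEntry rOne ;;
      .load rY rPos ;;
      .ite (.eq rY 1) .skip (.const rEntry 0)) ;;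
  .store rIdx rEntry ;;
  .ite (.eq rEntry rLen) (.const 0 1) (.const 0 0)

theorem loadEntry_spec {hi r j : ℕ} {P : List (Word w)} {σ : State w} {x : Word w}
    (hP : P ≠ []) (hready : Ready P σ) (hhi : hi ≤ 2 ^ w) (hr : (σ.reg 0).toNat = r)
    (hx : σ.reg 1 = x) (hfit : 2048 * P.length + r < hi)
    (hj : (σ.mem (2048 * P.length + r)).toNat = j) (hjm : j ≤ P.length) :
    Reach (2048 * P.length) hi loadEntry σ fun τ => Agree 8 σ τ ∧ τ.mem = σ.mem ∧
      (τ.reg rIdx).toNat = 2048 * P.length + r ∧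
      τ.reg rEntry = σ.mem (cell σ.mem (P.length + 1) j x) := by
  have hm0 : 0 < P.length := List.length_pos_iff.2 hP
  have hrow := hready.row j hjm
  have hrows := hready.rows
  have p0 : (σ.reg rStreams + σ.reg 0).toNat = 2048 * P.length + r := by
    have : (σ.reg rStreams).toNat = 2048 * P.length := by
      rw [hready.streams]
      exact toNat_ofNat_of_lt (by omega)
    rw [toNat_add_of_lt] <;> rw [this, hr]
    omega
  set J := σ.mem (2048 * P.length + r) with hJ
  have p1 : (σ.reg rRows + J).toNat = P.length + 1 + j := by
    rw [toNat_add_of_lt] <;> rw [hrows, hj]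
    omega
  have p2 : (σ.reg rRows + J + σ.reg rRows).toNat = 2 * (P.length + 1) + j := by
    rw [toNat_add_of_lt] <;> rw [p1, hrows] <;> omega
  have p3 : (σ.reg rRows + J + σ.reg rRows + σ.reg rRows).toNat = 3 * (P.length + 1) + j := by
    rw [toNat_add_of_lt] <;> rw [p2, hrows] <;> omega
  have hcell := hrow.cell_lt x
  have p4 : (σ.mem (3 * (P.length + 1) + j) +
      σ.mem (P.length + 1 + j) * x / σ.mem (2 * (P.length + 1) + j)).toNat =
      cell σ.mem (P.length + 1) j x := by
    rw [toNat_add_of_lt]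
    · rfl
    · exact lt_trans hcell (by omega)
  refine .seq (.op (.seq (.load ?_ (.seq (.op (.seq (.load ?_ (.seq (.op (.seq (.load ?_ (.seq (.op
    (.seq (.load ?_ (.seq (.op (.seq (.op (.seq (.op (.load ?_ ⟨fun d hd => ?_, ?_, ?_,
      ?_⟩))))))))))))))))))))))
  · simpa [Op.eval, p0, -BitVec.toNat_add] using hfit
  · simp [Op.eval, p0, ← hJ, p1, -BitVec.toNat_add]
    omega
  · simp [Op.eval, p0, ← hJ, p1, p2, -BitVec.toNat_add]
    omega
  · simp [Op.eval, p0, ← hJ, p1, p2, p3, -BitVec.toNat_add]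
    omega
  · simp [Op.eval, p0, ← hJ, p1, p2, p3, hx, p4, -BitVec.toNat_add]
    omega
  · simp [show d ≠ rIdx by omega, show d ≠ rState by omega, show d ≠ rPos by omega,
      show d ≠ rMul by omega, show d ≠ rDiv by omega, show d ≠ rBase by omega,
      show d ≠ rX by omega, show d ≠ rEntry by omega]
  · simp
  · simpa [Op.eval, -BitVec.toNat_add] using p0
  · simp [Op.eval, p0, ← hJ, p1, p2, p3, hx, p4, -BitVec.toNat_add]

theorem processArrival_spec {hi r j : ℕ} {P : List (Word w)} {σ : State w} {x : Word w}
    (hP : P ≠ []) (hready : Ready P σ) (hhi : hi ≤ 2 ^ w) (hr : (σ.reg 0).toNat = r)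
    (hx : σ.reg 1 = x) (hfit : 2048 * P.length + r < hi)
    (hj : (σ.mem (2048 * P.length + r)).toNat = j) (hjm : j ≤ P.length) :
    Reach (2048 * P.length) hi processArrival σ fun τ =>
      (∀ d, 2 ≤ d → d < 8 → τ.reg d = σ.reg d) ∧
      (∀ p, p ≠ 2048 * P.length + r → τ.mem p = σ.mem p) ∧
      (τ.mem (2048 * P.length + r)).toNat = matchLen P (P.take j ++ [x]) ∧
      τ.reg 0 = if matchLen P (P.take j ++ [x]) = P.length then 1 else 0 := by
  have hm0 : 0 < P.length := List.length_pos_iff.2 hP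
  have h1 : (1#w).toNat = 1 := toNat_one (by omega)
  have hE := (hready.row j hjm).entry_le x
  have hmatch := (hready.row j hjm).matchLen_eq x
  -- The last part of the program stores the new state and reports whether it is final.
  have final : ∀ υ : State w, Agree 8 σ υ → υ.mem = σ.mem →
      (υ.reg rIdx).toNat = 2048 * P.length + r →
      (υ.reg rEntry).toNat = matchLen P (P.take j ++ [x]) →
      Reach (2048 * P.length) hi (.store rIdx rEntry ;;
        .ite (.eq rEntry rLen) (.const 0 1) (.const 0 0)) υ fun τ =>
      (∀ d, 2 ≤ d → d < 8 → τ.reg d = σ.reg d) ∧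
      (∀ p, p ≠ 2048 * P.length + r → τ.mem p = σ.mem p) ∧
      (τ.mem (2048 * P.length + r)).toNat = matchLen P (P.take j ++ [x]) ∧
      τ.reg 0 = if matchLen P (P.take j ++ [x]) = P.length then 1 else 0 := by
    intro υ hreg hmem hidx hentry
    have hiff : υ.reg rEntry = υ.reg rLen ↔ matchLen P (P.take j ++ [x]) = P.length := by
      rw [← BitVec.toNat_inj, hentry, hreg rLen (by decide), hready.len]
    refine .seq (.store (by omega) (.ite (fun hc => .const ⟨fun d hd hd' => ?_, fun p hp => ?_, ?_,
      ?_⟩) fun hc => .const ⟨fun d hd hd' => ?_, fun p hp => ?_, ?_, ?_⟩) (by omega))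
    all_goals simp only [Test.Holds, State.reg_setMem, hiff] at hc
    · simp [show d ≠ 0 by omega, hreg d hd']
    · simp [hidx, hp, hmem]
    · simp [hidx, hentry]
    · simp [hc]
    · simp [show d ≠ 0 by omega, hreg d hd']
    · simp [hidx, hp, hmem]
    · simp [hidx, hentry]
    · simp [hc]
  refine .seq ((loadEntry_spec hP hready hhi hr hx hfit hj hjm).mono fun υ hυ => ?_)
  obtain ⟨hag, hmem, hidx, hentry⟩ := hυ
  set E := σ.mem (cell σ.mem (P.length + 1) j x) with hEdef
  have uz := (hag rZero (by decide)).trans hready.zero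
  have uone := (hag rOne (by decide)).trans hready.one
  have ux := (hag 1 (by decide)).trans hx
  refine .seq (.ite (fun hc => .skip (final υ hag hmem hidx ?_)) fun hc => ?_)
  all_goals simp only [Test.Holds, hentry, uz] at hc
  · rw [hentry, hmatch, if_neg (fun h => h.1 hc), hc]
    simp
  have hpos : 0 < E.toNat := Nat.pos_of_ne_zero fun h =>
    hc (BitVec.eq_of_toNat_eq (by simpa using h))
  have hsub : (E - 1#w).toNat = E.toNat - 1 := by
    rw [BitVec.toNat_sub_of_le (by rw [BitVec.le_def]; omega), h1]
  have hPx : υ.mem (E.toNat - 1) = P.getD (E.toNat - 1) 0 := by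
    rw [hmem, hready.letter (E.toNat - 1) (by omega)]
  refine .seq (.op (.seq (.load ?_ (.ite (fun hc' => .skip (final _ (fun d hd => ?_) ?_ ?_ ?_))
    fun hc' => .const (final _ (fun d hd => ?_) ?_ ?_ ?_)))))
  · simp [Op.eval, hentry, uone, hsub, -BitVec.toNat_sub]
    omega
  all_goals simp [Test.Holds, Op.eval, hentry, uone, ux, hsub, hPx, -BitVec.toNat_sub,
    -List.getD_eq_getElem?_getD] at hc'
  · simp [show d ≠ rPos by omega, show d ≠ rY by omega, hag d hd]
  · simpa using hmem
  · simpa using hidx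
  · rw [hmatch, if_pos ⟨hc, hc'⟩]
    simp [hentry]
  · simp [show d ≠ rPos by omega, show d ≠ rY by omega, show d ≠ rEntry by omega, hag d hd]
  · simpa using hmem
  · simpa using hidx
  · rw [hmatch, if_neg fun h => hc' h.2]
    simp

theorem processArrival_loopFree : processArrival.LoopFree := by
  simp [processArrival, loadEntry, Cmd.LoopFree]

theorem processArrival_steps_le : processArrival.steps ≤ 2048 := by
  simp [processArrival, loadEntry, Cmd.steps]

/-! ### Runs over arbitrary sequences of arrivals -/

theorem Ready.of_agree {P : List (Word w)} {σ τ : State w} (h : Ready P σ) (hP : P ≠ [])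
    (hreg : ∀ d, 2 ≤ d → d < 8 → τ.reg d = σ.reg d)
    (hmem : ∀ p < 2048 * P.length, τ.mem p = σ.mem p) : Ready P τ := by
  have hm0 : 0 < P.length := List.length_pos_iff.2 hP
  refine ⟨?_, ?_, ?_, ?_, ?_, fun i hi => ?_, fun j hj => ?_⟩
  · rw [hreg _ (by decide) (by decide), h.len]
  · rw [hreg _ (by decide) (by decide), h.rows]
  · rw [hreg _ (by decide) (by decide), h.streams]
  · rw [hreg _ (by decide) (by decide), h.one]
  · rw [hreg _ (by decide) (by decide), h.zero]
  · rw [hmem _ (by omega), h.letter i hi]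
  · exact (h.row j hj).congr le_rfl (hmem _ (by omega)) (hmem _ (by omega)) (hmem _ (by omega))
      fun p _ hp => hmem p hp

theorem streamText_succ {s : ℕ} (A : ℕ → Fin s × Word w) (n : ℕ) (r : Fin s) :
    streamText A (n + 1) r =
      if (A n).1 = r then streamText A n r ++ [(A n).2] else streamText A n r := by
  unfold streamText
  rw [List.range_succ, List.map_append, List.filter_append, List.map_append]
  split_ifs with h <;> simp [h]

/-- The invariant of the online phase: every stream has one cell, which holds the state of the
automaton after the contents of the stream. -/
structure Online {s : ℕ} (P : List (Word w)) (A : ℕ → Fin s × Word w) (n : ℕ) (σ : State w) :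
    Prop where
  ready : Ready P σ
  state : ∀ r : Fin s, (σ.mem (2048 * P.length + r)).toNat = matchLen P (streamText A n r)

theorem Online.step {s : ℕ} {P : List (Word w)} {A : ℕ → Fin s × Word w} {n : ℕ} {σ : State w}
    (hP : P ≠ []) (hs : 2048 * (P.length + s) ≤ 2 ^ w) (h : Online P A n σ) :
    ∃ τ, (∃ t ≤ 2048, Exec (2048 * P.length) (2048 * (P.length + s)) processArrival
        (σ.arrive (A n)) t τ) ∧ Online P A (n + 1) τ ∧
      τ.reg 0 = if P <:+ streamText A (n + 1) (A n).1 then 1 else 0 := by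
  have hr := (A n).1.isLt
  have hready : Ready P (σ.arrive (A n)) :=
    h.ready.of_agree hP
      (fun d hd _ => by simp [State.arrive, show d ≠ 0 by omega, show d ≠ 1 by omega])
      fun p _ => by simp [State.arrive]
  obtain ⟨t, τ, hexec, hreg, hmem, hstate, hans⟩ := processArrival_spec (r := (A n).1)
    (j := matchLen P (streamText A n (A n).1)) (x := (A n).2) hP hready hs
    (by simpa [State.arrive] using Nat.mod_eq_of_lt (show ((A n).1 : ℕ) < 2 ^ w by omega))
    (by simp [State.arrive]) (by omega) (by simpa [State.arrive] using h.state (A n).1)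
    (matchLen_le _ _)
  have htext : streamText A (n + 1) (A n).1 = streamText A n (A n).1 ++ [(A n).2] := by
    rw [streamText_succ, if_pos rfl]
  rw [← matchLen_append, ← htext] at hstate hans
  refine ⟨τ, ⟨t, (hexec.le_steps processArrival_loopFree).trans processArrival_steps_le, hexec⟩,
    ⟨hready.of_agree hP hreg fun p hp => hmem p (by omega), fun r => ?_⟩, ?_⟩
  · by_cases hrn : (A n).1 = r
    · rw [← hrn]
      exact hstate
    · have hne : (r : ℕ) ≠ (A n).1 := fun h => hrn (Fin.ext h.symm)
      rw [hmem _ (by omega), streamText_succ, if_neg hrn]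
      simpa [State.arrive] using h.state r
  · simp only [hans, suffix_iff_matchLen_eq]

theorem matchesOnline_processArrival {s : ℕ} {P : List (Word w)} {A : ℕ → Fin s × Word w}
    {σ₀ : State w} (hP : P ≠ []) (hs : 2048 * (P.length + s) ≤ 2 ^ w) (h : Online P A 0 σ₀) :
    MatchesOnline (2048 * P.length) (2048 * (P.length + s)) 2048 processArrival P σ₀ A := by
  choose next hexec honline hans using fun n (σ : { σ : State w // Online P A n σ }) =>
    σ.2.step hP hs
  let run : (n : ℕ) → { σ : State w // Online P A n σ } := fun n =>
    Nat.rec ⟨σ₀, h⟩ (fun n σ => ⟨next n σ, honline n σ⟩) n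
  exact ⟨fun n => (run n).1, rfl, fun n => ⟨hexec n (run n), hans n (run n)⟩⟩

end WordRAM

open WordRAM in
theorem theorem1 :
    ∃ (c : ℕ) (pre step : WordRAM.Cmd),
      ∀ (w : ℕ) (P : List (WordRAM.Word w)), P ≠ [] → c * P.length ≤ 2 ^ w →
        ∃ (t₀ : ℕ) (σ₀ : WordRAM.State w),
          WordRAM.Exec 0 (c * P.length) pre (WordRAM.initState P) t₀ σ₀ ∧
          ∀ s : ℕ, c * (P.length + s) ≤ 2 ^ w →
            ∀ A : ℕ → Fin s × WordRAM.Word w,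
              WordRAM.MatchesOnline (c * P.length) (c * (P.length + s)) c step P σ₀ A := by
  refine ⟨2048, preprocess, processArrival, fun w P hP hm => ?_⟩
  obtain ⟨t₀, σ₀, hexec, hready⟩ := preprocess_spec hP hm
  refine ⟨t₀, σ₀, hexec, fun s hs A => matchesOnline_processArrival hP hs ⟨hready, fun r => ?_⟩⟩
  -- The cells of the streams still contain `0`, the initial state of the automaton.
  rw [hexec.mem_of_le (by omega)]
  have hnil : streamText A 0 r = [] := by simp [streamText]
  rw [hnil, matchLen_nil]
  simp [initState, List.getElem?_eq_none (show P.length ≤ 2048 * P.length + r by omega)]
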